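/- Let $k\ge 1$, let $X$ be a compact Hausdorff space, and let $\mathcal M\to X$ be a matrix bundle: a bundle of $C^*$-algebras that is, locally on $X$, isomorphic to $U\times M_n(\mathbb C)$ by trivializations respecting the $C^*$-algebra structures of the fibers, where $n\ge 1$ is locally constant on $X$ but may vary. Let $\triangleright$ be an action of $\mathbb Z/k$ on $\mathcal M$ by bundle automorphisms covering $\mathrm{id}_X$ that are $*$-automorphisms of each fiber $\mathcal M_x$. Let $\Gamma(\mathcal M)$ be the unital $C^*$-algebra of continuous sections (pointwise operations, supremum norm), with the induced $\mathbb Z/k$-action. For an action $\alpha$ of a finite group $G$ on a unital $C^*$-algebra $A$: * the weak local-triviality dimension $\dim_{\mathrm{WLT}}^{G}(A)\in\mathbb N\cup\{\infty\}$ is the infimum of the $n\in\mathbb N$ for which there are $G$-equivariant $*$-homomorphisms $\rho_0,\dots,\rho_n\colon C_0((0,1])\otimes C(G)\to A$ with $\sum_{j=0}^n\rho_j(t\otimes 1)$ invertible, where $t$ is the identity function on $(0,1]$ and $G$ acts on $C(G)$ by translation; * $\alpha$ is free if the elements $(a\otimes 1)\,\delta(b)$, $a,b\in A$, span a dense subspace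 of $A\otimes C(G)=\{\text{functions }G\to A\}$, where $\delta(b)(g)=\alpha_g(b)$. At every $x\in X$ there is a unitary $v_x\in\mathcal M_x$ with $v_x^k=1$ inducing the action, i.e. such that the generator $1\in\mathbb Z/k$ acts on $\mathcal M_x$ as $a\mapsto v_xav_x^*$. Moreover, the following conditions are equivalent. 1. For every $x\in X$, each unitary $v_x\in\mathcal M_x$ with $v_x^k=1$ inducing the action has full spectrum, i.e. its spectrum is $\{z\in\mathbb C : z^k=1\}$. 2. $\dim_{\mathrm{WLT}}^{\mathbb Z/k}(\Gamma(\mathcal M))<\infty$. 3. The action of $\mathbb Z/k$ on $\Gamma(\mathcal M)$ induced by $\triangleright$ is free. -/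

import Mathlib

open Bundle
open scoped ENNReal ZeroAtInfty

noncomputable section

/-! ## Actions on unital `C*`-algebras: weak local-triviality dimension and freeness -/

/-- The function `t ↦ t` in `C₀((0, 1])`. -/
def coneCoord : C₀(Set.Ioc (0 : ℝ) 1, ℂ) where
  toFun t := ((t : ℝ) : ℂ)
  continuous_toFun := by fun_prop
  zero_at_infty' := by
    rw [Metric.tendsto_nhds]
    intro ε hε
    have hK : IsCompact {t : Set.Ioc (0 : ℝ) 1 | ε ≤ (t : ℝ)} := by
      rw [Subtype.isCompact_iff]
      have : Subtype.val '' {t : Set.Ioc (0 : ℝ) 1 | ε ≤ (t : ℝ)} = Set.Icc ε 1 := by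
        ext r
        simp only [Set.mem_image, Set.mem_ofPred_eq, Subtype.exists, Set.mem_Ioc, Set.mem_Icc]
        constructor
        · rintro ⟨a, h, h', rfl⟩
          exact ⟨h', h.2⟩
        · rintro ⟨h, h'⟩
          exact ⟨r, ⟨hε.trans_le h, h'⟩, h, rfl⟩
      rw [this]
      exact isCompact_Icc
    filter_upwards [hK.compl_mem_cocompact] with t ht
    simp only [Set.mem_compl_iff, Set.mem_ofPred_eq, not_le] at ht
    simpa [abs_of_pos t.2.1] using ht

section Actions

variable (G : Type*) [Group G] [Finite G] {A : Type*} [CStarAlgebra A]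

/-- For a finite group `G`, the `C*`-algebra `C₀((0, 1]) ⊗ C(G)`, realised as the algebra of
functions from `G` to `C₀((0, 1])`; the elementary tensor `f ⊗ p` is `g ↦ p g • f`. -/
abbrev ConeAlgebra : Type _ := G → C₀(Set.Ioc (0 : ℝ) 1, ℂ)

variable {G}

/-- The action of `G` on `C₀((0, 1]) ⊗ C(G)` by translation in the second tensor factor. -/
def ConeAlgebra.translate (h : G) (F : ConeAlgebra G) : ConeAlgebra G := fun g => F (g * h)

/-- `n` is admissible for the weak local-triviality dimension of the action `α` of the finite
group `G` if there are `G`-equivariant `*`-homomorphisms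
`ρ₀, …, ρₙ : C₀((0, 1]) ⊗ C(G) → A` with `∑ ρⱼ (t ⊗ 1)` invertible. -/
def IsWeakLTAdmissible (α : G →* (A ≃⋆ₐ[ℂ] A)) (n : ℕ) : Prop :=
  ∃ ρ : Fin (n + 1) → (ConeAlgebra G →⋆ₙₐ[ℂ] A),
    (∀ j h F, ρ j (ConeAlgebra.translate h F) = α h (ρ j F)) ∧
      IsUnit (∑ j, ρ j (fun _ => coneCoord))

/-- The weak local-triviality dimension of an action of a finite group on a unital
`C*`-algebra: the infimum of the admissible `n`, and `∞` if there is none. -/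
def weakLTDim (α : G →* (A ≃⋆ₐ[ℂ] A)) : ℕ∞ :=
  sInf {d : ℕ∞ | ∃ n : ℕ, d = n ∧ IsWeakLTAdmissible α n}

/-- Freeness of an action `α` of a finite group `G` on a unital `C*`-algebra `A`. With
`A ⊗ C(G)` realised as the algebra of functions from `G` to `A`, with the coaction
`δ(b) = (g ↦ α g b)`: the elements `(a ⊗ 1) δ(b)` span a dense subspace of `A ⊗ C(G)`. -/
def IsFreeAction (α : G →* (A ≃⋆ₐ[ℂ] A)) : Prop :=
  Dense (Submodule.span ℂ {F : G → A | ∃ a b : A, F = fun g => a * α g b} : Set (G → A))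

end Actions

/-! ## Matrix bundles

A bundle over `X` is given by its fibers `E x` and a topology on the total space
`TotalSpace Unit E`. The argument `Unit` is a placeholder with no meaning: Mathlib
keeps a model fiber there, but the size of the matrices may vary here. -/

section MatrixBundles

variable {X : Type*} [TopologicalSpace X] (E : X → Type*) [∀ x, CStarAlgebra (E x)]
  [TopologicalSpace (TotalSpace Unit E)]

variable {E} in
/-- The trivialization `e` respects the `*`-algebra structure of the fibers. -/
def IsStarAlgTrivialization {n : ℕ}
    (e : Trivialization (Matrix (Fin n) (Fin n) ℂ)
      (TotalSpace.proj : TotalSpace Unit E → X)) : Prop :=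
  ∀ x ∈ e.baseSet, ∃ φ : E x ≃⋆ₐ[ℂ] Matrix (Fin n) (Fin n) ℂ, ∀ a, e ⟨x, a⟩ = (x, φ a)

/-- A matrix bundle: around every point of the base, there is a local trivialization with fiber
`Mₙ(ℂ)`, for some `n ≥ 1` that may depend on the point, which is a `*`-isomorphism on the
fibers. -/
class IsMatrixBundle : Prop where
  exists_trivialization : ∀ x₀ : X, ∃ n : ℕ, 0 < n ∧
    ∃ e : Trivialization (Matrix (Fin n) (Fin n) ℂ) (TotalSpace.proj : TotalSpace Unit E → X),
      x₀ ∈ e.baseSet ∧ IsStarAlgTrivialization e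

variable {E} in
/-- Continuity of a section. -/
def IsContSection (s : ∀ x, E x) : Prop :=
  Continuous fun x => (⟨x, s x⟩ : TotalSpace Unit E)

section Helpers

set_option linter.unusedSectionVars false

variable {E} {n : ℕ}
  {e : Trivialization (Matrix (Fin n) (Fin n) ℂ) (TotalSpace.proj : TotalSpace Unit E → X)}

open scoped Matrix.Norms.L2Operator

theorem continuousAt_section_iff {s : ∀ x, E x} {x₀ : X} (h : x₀ ∈ e.baseSet) :
    ContinuousAt (fun x => (⟨x, s x⟩ : TotalSpace Unit E)) x₀ ↔
      ContinuousAt (fun x => (e ⟨x, s x⟩).2) x₀ := by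
  unfold ContinuousAt
  rw [e.tendsto_nhds_iff (by simpa [e.source_eq] using h)]
  exact and_iff_right Filter.tendsto_id

theorem IsStarAlgTrivialization.norm_eq (he : IsStarAlgTrivialization e) {x : X}
    (hx : x ∈ e.baseSet) (a : E x) : ‖(e ⟨x, a⟩).2‖ = ‖a‖ := by
  obtain ⟨φ, hφ⟩ := he x hx
  rw [hφ]
  exact NonUnitalStarAlgHom.norm_map φ φ.injective a

theorem IsStarAlgTrivialization.sub_eq (he : IsStarAlgTrivialization e) {x : X}
    (hx : x ∈ e.baseSet) (a b : E x) :
    (e ⟨x, a - b⟩).2 = (e ⟨x, a⟩).2 - (e ⟨x, b⟩).2 := by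
  obtain ⟨φ, hφ⟩ := he x hx
  simp [hφ]

theorem IsContSection.of_local [IsMatrixBundle E] {s : ∀ x, E x}
    (H : ∀ (x₀ : X) (n : ℕ) (e : Trivialization (Matrix (Fin n) (Fin n) ℂ)
      (TotalSpace.proj : TotalSpace Unit E → X)), x₀ ∈ e.baseSet → IsStarAlgTrivialization e →
      ContinuousAt (fun x => (e ⟨x, s x⟩).2) x₀) : IsContSection s := by
  refine continuous_iff_continuousAt.2 fun x₀ => ?_
  obtain ⟨n, -, e, hx, he⟩ := IsMatrixBundle.exists_trivialization (E := E) x₀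
  exact (continuousAt_section_iff hx).2 (H x₀ n e hx he)

theorem IsContSection.local {s : ∀ x, E x} (hs : IsContSection s) {x₀ : X}
    (h : x₀ ∈ e.baseSet) : ContinuousAt (fun x => (e ⟨x, s x⟩).2) x₀ :=
  (continuousAt_section_iff h).1 hs.continuousAt

theorem eventually_baseSet {x₀ : X} (h : x₀ ∈ e.baseSet) : ∀ᶠ x in nhds x₀, x ∈ e.baseSet :=
  e.open_baseSet.mem_nhds h

theorem IsContSection.continuous_norm [IsMatrixBundle E] {s : ∀ x, E x} (hs : IsContSection s) :
    Continuous fun x => ‖s x‖ := by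
  refine continuous_iff_continuousAt.2 fun x₀ => ?_
  obtain ⟨n, -, e, hx, he⟩ := IsMatrixBundle.exists_trivialization (E := E) x₀
  refine (hs.local hx).norm.congr ?_
  filter_upwards [eventually_baseSet hx] with x hx'
  exact he.norm_eq hx' _

theorem IsContSection.memℓp [IsMatrixBundle E] [CompactSpace X] {s : ∀ x, E x}
    (hs : IsContSection s) : Memℓp s ∞ :=
  memℓp_infty (isCompact_range hs.continuous_norm).bddAbove

end Helpers

/-- The continuous sections of a matrix bundle, with pointwise operations. -/
def contSections [IsMatrixBundle E] : StarSubalgebra ℂ (∀ x, E x) where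
  carrier := {s | IsContSection s}
  mul_mem' {s t} hs ht := .of_local fun x₀ n e hx he => by
    refine ((hs.local hx).mul (ht.local hx)).congr ?_
    filter_upwards [eventually_baseSet hx] with x hx'
    obtain ⟨φ, hφ⟩ := he x hx'
    simp [hφ]
  add_mem' {s t} hs ht := .of_local fun x₀ n e hx he => by
    refine ((hs.local hx).add (ht.local hx)).congr ?_
    filter_upwards [eventually_baseSet hx] with x hx'
    obtain ⟨φ, hφ⟩ := he x hx'
    simp [hφ]
  algebraMap_mem' c := .of_local fun x₀ n e hx he => by
    refine (continuousAt_const (y := algebraMap ℂ (Matrix (Fin n) (Fin n) ℂ) c)).congr ?_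
    filter_upwards [eventually_baseSet hx] with x hx'
    obtain ⟨φ, hφ⟩ := he x hx'
    simp only [hφ, Pi.algebraMap_apply]
    exact (AlgHomClass.commutes φ c).symm
  star_mem' {s} hs := .of_local fun x₀ n e hx he => by
    refine (hs.local hx).star.congr ?_
    filter_upwards [eventually_baseSet hx] with x hx'
    obtain ⟨φ, hφ⟩ := he x hx'
    simp [hφ, map_star]

/-- The section algebra `Γ(E)` of a matrix bundle over a compact space: continuous sections
with pointwise operations and the supremum norm. -/
def SectionAlgebra [IsMatrixBundle E] : Type _ := contSections E

namespace SectionAlgebra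

variable [IsMatrixBundle E]

instance : Ring (SectionAlgebra E) := inferInstanceAs (Ring (contSections E))
instance : StarRing (SectionAlgebra E) := inferInstanceAs (StarRing (contSections E))
instance : Algebra ℂ (SectionAlgebra E) := inferInstanceAs (Algebra ℂ (contSections E))
instance : StarModule ℂ (SectionAlgebra E) := inferInstanceAs (StarModule ℂ (contSections E))

variable {E}

/-- Build an element of `Γ(E)` from a continuous section. -/
def mk (s : ∀ x, E x) (hs : IsContSection s) : SectionAlgebra E := ⟨s, hs⟩

instance : DFunLike (SectionAlgebra E) X E := ⟨fun s => s.1, Subtype.val_injective⟩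

theorem isContSection (s : SectionAlgebra E) : IsContSection s := s.2

@[ext] theorem ext {s t : SectionAlgebra E} (h : ∀ x, s x = t x) : s = t :=
  DFunLike.ext s t h

@[simp] theorem mk_apply (s : ∀ x, E x) (hs : IsContSection s) (x : X) : mk s hs x = s x := rfl
@[simp] theorem add_apply (s t : SectionAlgebra E) (x : X) : (s + t) x = s x + t x := rfl
@[simp] theorem sub_apply (s t : SectionAlgebra E) (x : X) : (s - t) x = s x - t x := rfl
@[simp] theorem mul_apply (s t : SectionAlgebra E) (x : X) : (s * t) x = s x * t x := rfl
@[simp] theorem one_apply (x : X) : (1 : SectionAlgebra E) x = 1 := rfl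
@[simp] theorem zero_apply (x : X) : (0 : SectionAlgebra E) x = 0 := rfl
@[simp] theorem smul_apply (c : ℂ) (s : SectionAlgebra E) (x : X) : (c • s) x = c • s x := rfl
@[simp] theorem star_apply (s : SectionAlgebra E) (x : X) : (star s) x = star (s x) := rfl

variable [CompactSpace X]

variable (E) in
/-- The inclusion of `Γ(E)` into the bounded families, which carry the supremum norm. -/
def toLp : SectionAlgebra E →ₙ+* lp E ∞ where
  toFun s := ⟨(s : ∀ x, E x), s.isContSection.memℓp⟩
  map_mul' _ _ := rfl
  map_zero' := rfl
  map_add' _ _ := rfl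

theorem toLp_injective : Function.Injective (toLp E) := fun _ _ h =>
  ext fun x => congrFun (congrArg Subtype.val h) x

instance : NormedRing (SectionAlgebra E) :=
  { NonUnitalNormedRing.induced (SectionAlgebra E) (lp E ∞) (toLp E) toLp_injective,
    (inferInstance : Ring (SectionAlgebra E)) with }

theorem norm_eq_norm_toLp (s : SectionAlgebra E) : ‖s‖ = ‖toLp E s‖ := rfl

theorem norm_def (s : SectionAlgebra E) : ‖s‖ = ⨆ x, ‖s x‖ := rfl

theorem norm_apply_le (s : SectionAlgebra E) (x : X) : ‖s x‖ ≤ ‖s‖ :=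
  le_ciSup (isCompact_range s.isContSection.continuous_norm).bddAbove x

instance : NormedAlgebra ℂ (SectionAlgebra E) where
  norm_smul_le c s := norm_smul_le c (toLp E s)

instance : CStarRing (SectionAlgebra E) where
  norm_mul_self_le s := CStarRing.norm_mul_self_le (toLp E s)

open scoped Matrix.Norms.L2Operator in
instance : CompleteSpace (SectionAlgebra E) := by
  have hiso : Isometry (toLp E) := AddMonoidHomClass.isometry_of_norm _ fun _ => rfl
  refine (completeSpace_iff_isComplete_range hiso.isUniformInducing).2 (IsClosed.isComplete ?_)
  refine isClosed_of_closure_subset fun f hf => ?_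
  suffices hfc : IsContSection (f : ∀ x, E x) from ⟨mk f hfc, rfl⟩
  refine .of_local fun x₀ n e hx he => ?_
  refine continuousAt_of_locally_uniform_approx_of_continuousAt fun u hu => ?_
  obtain ⟨ε, hε, hεu⟩ := Metric.mem_uniformity_dist.1 hu
  obtain ⟨_, ⟨s, rfl⟩, hs⟩ := Metric.mem_closure_iff.1 hf ε hε
  refine ⟨e.baseSet, eventually_baseSet hx, fun x => (e ⟨x, s x⟩).2,
    s.isContSection.local hx, fun x hx' => hεu ?_⟩
  rw [dist_eq_norm, ← he.sub_eq hx', he.norm_eq hx']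
  rw [dist_eq_norm] at hs
  exact (lp.norm_apply_le_norm ENNReal.top_ne_zero (f - toLp E s) x).trans_lt hs

instance : CStarAlgebra (SectionAlgebra E) where

end SectionAlgebra

/-! ## Actions on matrix bundles -/

/-- An action of the discrete group `G` on a matrix bundle: `G` acts on each fiber by
`*`-automorphisms, and each `g` acts continuously on the total space. -/
structure BundleAction (G : Type*) [Group G] where
  fiber : ∀ x, G →* (E x ≃⋆ₐ[ℂ] E x)
  continuous_act : ∀ g, Continuous fun p : TotalSpace Unit E =>
    (⟨p.1, fiber p.1 g p.2⟩ : TotalSpace Unit E)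

namespace BundleAction

variable {E}

/-- The action `(g • s)(x) = g • s(x)` on `Γ(E)` induced by an action on the bundle. -/
def onSections [IsMatrixBundle E] {G : Type*} [Group G] (α : BundleAction E G) :
    G →* (SectionAlgebra E ≃⋆ₐ[ℂ] SectionAlgebra E) where
  toFun g :=
    { toFun := fun s =>
        .mk (fun x => α.fiber x g (s x)) ((α.continuous_act g).comp s.isContSection)
      invFun := fun s =>
        .mk (fun x => α.fiber x g⁻¹ (s x)) ((α.continuous_act g⁻¹).comp s.isContSection)
      left_inv := fun s => by
        ext x
        change (α.fiber x g⁻¹ * α.fiber x g) (s x) = s x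
        rw [← map_mul]; simp
      right_inv := fun s => by
        ext x
        change (α.fiber x g * α.fiber x g⁻¹) (s x) = s x
        rw [← map_mul]; simp
      map_mul' := fun s t => by ext x; exact map_mul (α.fiber x g) (s x) (t x)
      map_add' := fun s t => by ext x; exact map_add (α.fiber x g) (s x) (t x)
      map_star' := fun s => by ext x; exact map_star (α.fiber x g) (s x)
      map_smul' := fun c s => by ext x; exact map_smul (α.fiber x g) c (s x) }
  map_one' := by
    ext s x
    change α.fiber x 1 (s x) = s x
    simp
  map_mul' g h := by
    ext s x
    change α.fiber x (g * h) (s x) = α.fiber x g (α.fiber x h (s x))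
    simp

/-- `v` is a unitary in the fiber at `x`, with `v ^ k = 1`, and the generator `1` of `ℤ/k` acts
on that fiber as conjugation by `v`. -/
def IsImplementedAt {k : ℕ} (α : BundleAction E (Multiplicative (ZMod k))) (x : X) (v : E x) :
    Prop :=
  v ∈ unitary (E x) ∧ v ^ k = 1 ∧
    ∀ a : E x, α.fiber x (Multiplicative.ofAdd 1) a = v * a * star v

end BundleAction

end MatrixBundles

end

/-!
# Free actions of `ℤ/k` on matrix bundles

*Unitaries.* A `*`-automorphism `β` of `Mₙ(ℂ)` admits nonzero `T` with `T a = β(a) T`, namely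
`T = ∑ᵢ β(eᵢ₀) c e₀ᵢ` for suitable `c` (`intertwiner`). Both `T* T` and, if `β ^ k = 1`, `T ^ k` are
central, so a multiple of `T` is a unitary of order dividing `k` that implements `β`. This is
`BundleAction.exists_isImplementedAt`.

*Finite dimension implies freeness*, for every finite group and unital `C*`-algebra: with
`a_h = ρ(√t ⊗ δ_h)`, the element `∑_h a_h α_g(a_h)` is `ρ(t ⊗ 1)` for `g = 1` and `0` otherwise, so
dividing by the invertible sum of the `ρⱼ(t ⊗ 1)` gives all functions supported at one point
(`IsWeakLTAdmissible.isFreeAction`).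

*Freeness implies full spectrum.* If `z ^ k = 1` and `∑ₘ (z⁻¹ v) ^ m = 0`, then the continuous map
`F ↦ ∑ₘ F(m)(x) (z⁻¹ v) ^ m` vanishes on all `(a ⊗ 1) δ(b)`, hence identically, which is absurd
(`BundleAction.IsImplementedAt.spectrum_eq_of_isFreeAction`).

*Full spectrum implies finite dimension.* Near `x₀` the intertwiners give a continuous family of
implementing unitaries `V y` with `V y ^ k = 1` (`exists_local_unitary`). A unit vector `f` whose
components in the `k` eigenspaces of `V y` have equal norms is orthogonal to `V y ^ m f` for
`0 < m < k` (`cyclicVector`), so the projection onto `ℂ f` is orthogonal to its nontrivial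
translates. Multiplied by a bump function, it gives an equivariant homomorphism from the cone
(`isConeSum_of_projections`). Finitely many choices of `f` exhaust all eigenspaces, so the sum of
the corresponding `ρ(t ⊗ 1)` is invertible at `x₀`
(`BundleAction.IsImplementedAt.exists_isConeSum`). These sums are positive, so compactness of `X`
yields one that is invertible everywhere
(`exists_isWeakLTAdmissible_of_forall_isUnit_apply`).
-/

/-! ### Finite weak local-triviality dimension implies freeness -/

/-- The function `t ↦ √t` in `C₀((0, 1])`. -/
noncomputable def coneSqrt : C₀(Set.Ioc (0 : ℝ) 1, ℂ) where
  toFun t := ((√(t : ℝ) : ℝ) : ℂ)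
  continuous_toFun := by fun_prop
  zero_at_infty' := by
    have h := (coneCoord.zero_at_infty').norm
    have h2 := (Real.continuous_sqrt.tendsto _).comp h
    rw [tendsto_zero_iff_norm_tendsto_zero]
    simp only [norm_zero, Real.sqrt_zero] at h2
    refine h2.congr fun t => ?_
    have ht : ‖coneCoord.toFun t‖ = (t : ℝ) := by
      change ‖((t : ℝ) : ℂ)‖ = _
      rw [Complex.norm_real, Real.norm_of_nonneg t.2.1.le]
    simp only [Function.comp_apply, ht]
    rw [Complex.norm_real, Real.norm_of_nonneg (Real.sqrt_nonneg _)]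

theorem coneSqrt_mul_self : coneSqrt * coneSqrt = coneCoord := by
  ext t
  change ((√(t : ℝ) : ℝ) : ℂ) * ((√(t : ℝ) : ℝ) : ℂ) = ((t : ℝ) : ℂ)
  rw [← Complex.ofReal_mul, Real.mul_self_sqrt t.2.1.le]

theorem star_coneSqrt : star coneSqrt = coneSqrt := by
  ext t
  exact Complex.conj_ofReal _

section Actions

open Classical in
theorem ConeAlgebra.translate_single {G : Type*} [Group G] (h g : G)
    (f : C₀(Set.Ioc (0 : ℝ) 1, ℂ)) :
    ConeAlgebra.translate h (Pi.single g f) = Pi.single (g * h⁻¹) f := by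
  funext x
  simp only [ConeAlgebra.translate, Pi.single_apply, eq_mul_inv_iff_mul_eq]

variable {G : Type*} [Group G] [Finite G] {A : Type*} [CStarAlgebra A]

/-- The elements `ρⱼ(√t ⊗ δ_g)` of an admissible family give, up to the invertible element
`∑ ρⱼ(t ⊗ 1)`, every function `G → A` supported at one point. -/
theorem IsWeakLTAdmissible.isFreeAction {α : G →* (A ≃⋆ₐ[ℂ] A)} {n : ℕ}
    (h : IsWeakLTAdmissible α n) : IsFreeAction α := by
  classical
  obtain ⟨ρ, hρ, hu⟩ := h
  have := Fintype.ofFinite G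
  set S := Submodule.span ℂ {F : G → A | ∃ a b : A, F = fun g => a * α g b} with hS
  obtain ⟨w, hw⟩ := hu.exists_left_inv
  have key : ∀ (c : A) (h : G), (Pi.single h c : G → A) ∈ S := by
    intro c h
    have : (Pi.single h c : G → A) = ∑ j, ∑ g, (fun g' => (c * w * ρ j (Pi.single g coneSqrt)) *
        α g' (α h⁻¹ (ρ j (Pi.single g coneSqrt)))) := by
      funext g'
      have h1 : ∀ j g, (c * w * ρ j (Pi.single g coneSqrt)) *
          α g' (α h⁻¹ (ρ j (Pi.single g coneSqrt))) =
          if g' = h then c * w * ρ j (Pi.single g coneCoord) else 0 := by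
        intro j g
        rw [← hρ, ← hρ, ConeAlgebra.translate_single, ConeAlgebra.translate_single, mul_assoc,
          ← map_mul]
        split_ifs with hg
        · subst hg
          rw [inv_inv, mul_inv_cancel_right, ← Pi.single_mul, coneSqrt_mul_self]
        · have h0 : (Pi.single g coneSqrt : ConeAlgebra G) *
              Pi.single (g * h⁻¹⁻¹ * g'⁻¹) coneSqrt = 0 := by
            funext x
            simp only [Pi.mul_apply, Pi.single_apply, Pi.zero_apply]
            by_cases hx : x = g
            · refine mul_eq_zero_of_right _ (if_neg fun hx' => ?_)
              rw [hx, inv_inv, mul_assoc, left_eq_mul, mul_inv_eq_one] at hx'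
              exact hg hx'.symm
            · rw [if_neg hx, zero_mul]
          rw [h0, map_zero, mul_zero]
      simp only [Finset.sum_apply, h1]
      rw [Pi.single_apply]
      split_ifs
      · simp only [← Finset.mul_sum, ← map_sum]
        have h2 : ∑ g, (Pi.single g coneCoord : ConeAlgebra G) = fun _ => coneCoord :=
          Finset.univ_sum_single (fun _ : G => coneCoord)
        rw [h2, mul_assoc, hw, mul_one]
      · simp
    rw [this]
    exact S.sum_mem fun j _ => S.sum_mem fun g _ => Submodule.subset_span ⟨_, _, rfl⟩
  have htop : S = ⊤ := by
    refine eq_top_iff.2 fun F _ => ?_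
    rw [← Finset.univ_sum_single F]
    exact S.sum_mem fun g _ => key _ _
  change Dense (S : Set (G → A))
  rw [htop]
  exact dense_univ

end Actions

/-! ### Roots of unity in the spectrum -/

section EigenSum

variable {A : Type*} [Ring A] [Algebra ℂ A]

/-- If `v ^ k = 1` and `z ^ k = 1`, this is `k` times the projection onto the eigenspace of `v` at
the eigenvalue `z`. -/
noncomputable def eigenSum (k : ℕ) (z : ℂ) (v : A) : A := ∑ m ∈ Finset.range k, (z⁻¹ • v) ^ m

theorem smul_pow_eq_one {k : ℕ} {z : ℂ} {v : A} (hz : z ^ k = 1) (hv : v ^ k = 1) :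
    (z⁻¹ • v) ^ k = 1 := by
  rw [smul_pow, inv_pow, hz, hv, inv_one, one_smul]

theorem mul_eigenSum {k : ℕ} [NeZero k] {z : ℂ} {v : A} (hz : z ^ k = 1) (hv : v ^ k = 1) :
    v * eigenSum k z v = z • eigenSum k z v := by
  have hz0 : z ≠ 0 := by
    rintro rfl
    simp [NeZero.ne k] at hz
  have h := mul_geom_sum (z⁻¹ • v) k
  rw [smul_pow_eq_one hz hv, sub_self, sub_mul, one_mul, sub_eq_zero, smul_mul_assoc] at h
  calc v * eigenSum k z v = z • z⁻¹ • (v * eigenSum k z v) := by rw [smul_inv_smul₀ hz0]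
    _ = _ := by rw [eigenSum, h]

theorem mem_spectrum_of_eigenSum_ne_zero {k : ℕ} [NeZero k] {z : ℂ} {v : A} (hz : z ^ k = 1)
    (hv : v ^ k = 1) (h : eigenSum k z v ≠ 0) : z ∈ spectrum ℂ v := by
  intro hu
  refine h (hu.mul_right_eq_zero.1 (?_ : (algebraMap ℂ A z - v) * _ = 0))
  rw [sub_mul, mul_eigenSum hz hv, Algebra.smul_def, sub_self]

theorem eigenSum_ne_zero_of_mem_spectrum {k : ℕ} [NeZero k] {z : ℂ} {v : A} (hz : z ^ k = 1)
    (h : z ∈ spectrum ℂ v) : eigenSum k z v ≠ 0 := by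
  have hz0 : z ≠ 0 := by
    rintro rfl
    simp [NeZero.ne k] at hz
  intro h0
  refine h ?_
  change IsUnit (algebraMap ℂ A z - v)
  set w := z⁻¹ • v with hw
  set c := ∑ m ∈ Finset.range k, ∑ i ∈ Finset.range m, w ^ i with hc
  -- `1 - w` divides each `1 - w ^ m`, hence `∑ (1 - w ^ m) = k - ∑ w ^ m = k`.
  have h1 : (1 - w) * c = algebraMap ℂ A k := by
    rw [hc, Finset.mul_sum]
    simp only [mul_neg_geom_sum, Finset.sum_sub_distrib]
    change _ - eigenSum k z v = _
    simp [h0]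
  have hcomm : Commute (1 - w) c :=
    Commute.sum_right _ _ _ fun m _ => Commute.sum_right _ _ _ fun i _ =>
      ((Commute.one_left w).sub_left (Commute.refl w)).pow_right i
  have hk : IsUnit (algebraMap ℂ A k) :=
    (IsUnit.mk0 (k : ℂ) (Nat.cast_ne_zero.2 (NeZero.ne k))).map _
  have h2 : IsUnit (1 - w) := (hcomm.isUnit_mul_iff.1 (h1 ▸ hk)).1
  have h3 : algebraMap ℂ A z - v = algebraMap ℂ A z * (1 - w) := by
    rw [mul_sub, mul_one, hw, ← Algebra.smul_def, smul_inv_smul₀ hz0]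
  rw [h3]
  exact ((IsUnit.mk0 z hz0).map (algebraMap ℂ A)).mul h2

end EigenSum

/-! ### Automorphisms of matrix algebras of finite order are inner -/

section Intertwiner

variable {n : ℕ}

theorem Matrix.mul_single_one (a : Matrix (Fin n) (Fin n) ℂ) (i j : Fin n) :
    a * Matrix.single i j 1 = ∑ l, a l i • Matrix.single l j (1 : ℂ) := by
  ext p q
  simp only [Matrix.mul_apply, Matrix.sum_apply, Matrix.smul_apply, Matrix.single_apply,
    smul_eq_mul, mul_ite, mul_one, mul_zero]
  by_cases hq : j = q <;> simp [hq]

theorem Matrix.single_one_mul (a : Matrix (Fin n) (Fin n) ℂ) (i j : Fin n) :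
    Matrix.single i j 1 * a = ∑ l, a j l • Matrix.single i l (1 : ℂ) := by
  ext p q
  simp only [Matrix.mul_apply, Matrix.sum_apply, Matrix.smul_apply, Matrix.single_apply,
    smul_eq_mul, mul_ite, ite_mul, mul_one, one_mul, mul_zero, zero_mul]
  by_cases hq : i = p <;> simp [hq]

variable {β : Matrix (Fin n) (Fin n) ℂ ≃⋆ₐ[ℂ] Matrix (Fin n) (Fin n) ℂ}
  {T : Matrix (Fin n) (Fin n) ℂ}

theorem pow_mul_of_intertwines (hT : ∀ a, T * a = β a * T) (m : ℕ)
    (a : Matrix (Fin n) (Fin n) ℂ) : T ^ m * a = (β ^ m) a * T ^ m := by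
  induction m with
  | zero => simp
  | succ m ih =>
    rw [pow_succ', mul_assoc, ih, ← mul_assoc, hT, mul_assoc, ← pow_succ', pow_succ' β]
    rfl

theorem star_pow_mul_pow_of_star_mul_self {c : ℂ} (h : star T * T = c • 1) (m : ℕ) :
    star (T ^ m) * T ^ m = c ^ m • 1 := by
  induction m with
  | zero => simp
  | succ m ih =>
    rw [pow_succ', star_mul, mul_assoc, ← mul_assoc (star T), h, smul_mul_assoc, one_mul,
      mul_smul_comm, ih, smul_smul, pow_succ']

theorem smul_intertwines (hT : ∀ a, T * a = β a * T) (c : ℂ) (a : Matrix (Fin n) (Fin n) ℂ) :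
    (c • T) * a = β a * (c • T) := by
  rw [smul_mul_assoc, hT, mul_smul_comm]

variable [NeZero n]

theorem Matrix.eq_smul_one_of_forall_mul_comm {A : Matrix (Fin n) (Fin n) ℂ}
    (h : ∀ a, A * a = a * A) : A = A 0 0 • 1 := by
  obtain ⟨c, rfl⟩ := Matrix.mem_range_scalar_of_commute_single (M := A)
    fun i j _ => (h (Matrix.single i j 1)).symm
  ext i j
  simp [Matrix.scalar_apply, Matrix.diagonal_apply, Matrix.one_apply]

/-- `T` with `T a = β(a) T` for all `a`, built from a matrix `c` by averaging over the matrix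
units. It depends continuously on `β`. -/
def intertwiner (β : Matrix (Fin n) (Fin n) ℂ ≃⋆ₐ[ℂ] Matrix (Fin n) (Fin n) ℂ)
    (c : Matrix (Fin n) (Fin n) ℂ) : Matrix (Fin n) (Fin n) ℂ :=
  ∑ i, β (Matrix.single i 0 1) * c * Matrix.single 0 i 1

theorem intertwiner_mul (β : Matrix (Fin n) (Fin n) ℂ ≃⋆ₐ[ℂ] Matrix (Fin n) (Fin n) ℂ)
    (c a : Matrix (Fin n) (Fin n) ℂ) : intertwiner β c * a = β a * intertwiner β c := by
  have h1 : intertwiner β c * a =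
      ∑ i, ∑ j, a i j • (β (Matrix.single i 0 1) * c * Matrix.single 0 j 1) := by
    simp only [intertwiner, Finset.sum_mul, mul_assoc, Matrix.single_one_mul, Finset.mul_sum,
      mul_smul_comm]
  have h2 : β a * intertwiner β c =
      ∑ j, ∑ i, a i j • (β (Matrix.single i 0 1) * c * Matrix.single 0 j 1) := by
    rw [intertwiner, Finset.mul_sum]
    refine Finset.sum_congr rfl fun j _ => ?_
    rw [← mul_assoc, ← mul_assoc, ← map_mul, Matrix.mul_single_one a, map_sum, Finset.sum_mul,
      Finset.sum_mul]
    simp only [map_smul, smul_mul_assoc]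
  rw [h1, h2, Finset.sum_comm]

theorem exists_intertwiner_ne_zero
    (β : Matrix (Fin n) (Fin n) ℂ ≃⋆ₐ[ℂ] Matrix (Fin n) (Fin n) ℂ) :
    ∃ c, intertwiner β c ≠ 0 := by
  have h0 : β (Matrix.single 0 0 1) ≠ 0 := by
    rw [Ne, map_eq_zero_iff β β.injective]
    intro h
    simpa using congrFun (congrFun h 0) 0
  obtain ⟨p, q, hpq⟩ : ∃ p q, β (Matrix.single 0 0 1) p q ≠ 0 := by
    by_contra! h
    exact h0 (Matrix.ext h)
  -- With `c = e_{q0}`, the first column of the intertwiner is column `q` of `β(e₀₀)`.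
  refine ⟨Matrix.single q 0 1, fun h => hpq ?_⟩
  have h1 : intertwiner β (Matrix.single q 0 1) * Matrix.single 0 0 1 =
      β (Matrix.single 0 0 1) * Matrix.single q 0 1 := by
    rw [intertwiner, Finset.sum_mul, Finset.sum_eq_single 0]
    · simp [mul_assoc]
    · intro i _ hi
      rw [mul_assoc, Matrix.single_mul_single_of_ne _ _ _ _ hi, mul_zero]
    · simp
  rw [h, zero_mul] at h1
  simpa using (congrFun (congrFun h1 p) 0).symm

theorem intertwiner_self {β : Matrix (Fin n) (Fin n) ℂ ≃⋆ₐ[ℂ] Matrix (Fin n) (Fin n) ℂ}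
    {v : Matrix (Fin n) (Fin n) ℂ} (hv : v ∈ unitary (Matrix (Fin n) (Fin n) ℂ))
    (hβ : ∀ a, β a = v * a * star v) : intertwiner β v = v := by
  have h : ∀ i, β (Matrix.single i 0 1) * v * Matrix.single 0 i 1 =
      v * Matrix.single i i 1 := by
    intro i
    rw [hβ, mul_assoc _ (star v), Unitary.star_mul_self_of_mem hv, mul_one, mul_assoc,
      Matrix.single_mul_single_same, one_mul]
  rw [intertwiner, Finset.sum_congr rfl fun i _ => h i, ← Finset.mul_sum,
    Matrix.sum_single_one, mul_one]

theorem exists_star_mul_self_of_intertwines (hT : ∀ a, T * a = β a * T) :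
    ∃ r : ℝ, 0 ≤ r ∧ star T * T = (r : ℂ) • 1 := by
  refine ⟨∑ i, ‖T i 0‖ ^ 2, by positivity, ?_⟩
  have h : star T * T = (star T * T) 0 0 • 1 := by
    refine Matrix.eq_smul_one_of_forall_mul_comm fun a => ?_
    have h1 : star T * β a = a * star T := by
      have := congrArg star (hT (star a))
      simpa [map_star] using this.symm
    rw [mul_assoc, hT, ← mul_assoc, h1, mul_assoc]
  rw [h]
  congr 1
  simp [Matrix.mul_apply, Matrix.star_apply, Complex.conj_mul']

theorem pow_eq_smul_one_of_intertwines {k : ℕ} (hT : ∀ a, T * a = β a * T) (hβ : β ^ k = 1) :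
    T ^ k = (T ^ k) 0 0 • 1 :=
  Matrix.eq_smul_one_of_forall_mul_comm fun a => by
    rw [pow_mul_of_intertwines hT, hβ]
    rfl

open scoped ComplexOrder in
theorem pow_apply_ne_zero_of_intertwines {k : ℕ} (hT : ∀ a, T * a = β a * T) (hβ : β ^ k = 1)
    (h0 : T ≠ 0) : (T ^ k) 0 0 ≠ 0 := by
  intro h
  obtain ⟨r, -, hr⟩ := exists_star_mul_self_of_intertwines hT
  have h1 := star_pow_mul_pow_of_star_mul_self hr k
  rw [pow_eq_smul_one_of_intertwines hT hβ, h, zero_smul, mul_zero] at h1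
  have h2 : (r : ℂ) ^ k = 0 := by simpa using (congrFun (congrFun h1 0) 0).symm
  rw [eq_zero_of_pow_eq_zero h2, zero_smul] at hr
  exact h0 (Matrix.conjTranspose_mul_self_eq_zero.1 hr)

/-- `star T * T` is a nonnegative scalar whose `k`-th power is `1`. -/
theorem unitary_of_intertwines {k : ℕ} [NeZero k] (hT : ∀ a, T * a = β a * T) (h : T ^ k = 1) :
    T ∈ unitary (Matrix (Fin n) (Fin n) ℂ) ∧ ∀ a, β a = T * a * star T := by
  obtain ⟨r, hr0, hr⟩ := exists_star_mul_self_of_intertwines hT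
  have h1 := star_pow_mul_pow_of_star_mul_self hr k
  rw [h, star_one, one_mul] at h1
  have h2 : (r : ℂ) ^ k = 1 := by simpa using (congrFun (congrFun h1 0) 0).symm
  have h3 : r = 1 := (pow_eq_one_iff_of_nonneg hr0 (NeZero.ne k)).1 (by exact_mod_cast h2)
  rw [h3, Complex.ofReal_one, one_smul] at hr
  have h4 : T * star T = 1 := mul_eq_one_comm.1 hr
  exact ⟨Unitary.mem_iff.2 ⟨hr, h4⟩, fun a => by rw [hT, mul_assoc, h4, mul_one]⟩

theorem inv_smul_pow_eq_one_of_intertwines {k : ℕ} (hT : ∀ a, T * a = β a * T) (hβ : β ^ k = 1)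
    (h0 : T ≠ 0) {μ : ℂ} (hμ : μ ^ k = (T ^ k) 0 0) : (μ⁻¹ • T) ^ k = 1 := by
  rw [smul_pow, inv_pow, hμ, pow_eq_smul_one_of_intertwines hT hβ, Matrix.smul_apply,
    Matrix.one_apply_eq, smul_smul, smul_eq_mul, mul_one,
    inv_mul_cancel₀ (pow_apply_ne_zero_of_intertwines hT hβ h0), one_smul]

theorem exists_unitary_of_pow_eq_one {k : ℕ} [NeZero k] (hβ : β ^ k = 1) :
    ∃ v ∈ unitary (Matrix (Fin n) (Fin n) ℂ), v ^ k = 1 ∧ ∀ a, β a = v * a * star v := by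
  obtain ⟨c, hc⟩ := exists_intertwiner_ne_zero β
  have hT := intertwiner_mul β c
  obtain ⟨μ, hμ⟩ := IsAlgClosed.exists_pow_nat_eq ((intertwiner β c ^ k) 0 0) (NeZero.pos k)
  have h1 := inv_smul_pow_eq_one_of_intertwines hT hβ hc hμ
  obtain ⟨h2, h3⟩ := unitary_of_intertwines (smul_intertwines hT μ⁻¹) h1
  exact ⟨_, h2, h1, h3⟩

end Intertwiner

/-! ### The fibers of a matrix bundle with an action -/

section Fibers

theorem StarAlgEquiv.conj_pow_apply {A B : Type*} [Ring A] [StarRing A] [Algebra ℂ A]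
    [Ring B] [StarRing B] [Algebra ℂ B] (φ : A ≃⋆ₐ[ℂ] B) (γ : A ≃⋆ₐ[ℂ] A) (m : ℕ) (b : B) :
    (((φ.symm.trans γ).trans φ) ^ m) b = φ ((γ ^ m) (φ.symm b)) := by
  induction m with
  | zero => simp
  | succ m ih =>
    rw [pow_succ', pow_succ']
    change ((φ.symm.trans γ).trans φ) ((((φ.symm.trans γ).trans φ) ^ m) b) = _
    rw [ih]
    simp

theorem StarAlgEquiv.pow_apply_of_conj {A : Type*} [Ring A] [StarRing A] [Algebra ℂ A]
    {β : A ≃⋆ₐ[ℂ] A} {v : A} (h : ∀ a, β a = v * a * star v) (m : ℕ) (a : A) :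
    (β ^ m) a = v ^ m * a * star (v ^ m) := by
  induction m with
  | zero => simp
  | succ m ih =>
    rw [pow_succ', pow_succ' v]
    change β ((β ^ m) a) = _
    rw [ih, h, star_mul]
    simp only [mul_assoc]

variable {X : Type*} {E : X → Type*} [∀ x, CStarAlgebra (E x)]
  [TopologicalSpace (TotalSpace Unit E)]
  {k : ℕ} {α : BundleAction E (Multiplicative (ZMod k))} {x : X} {v : E x}

theorem BundleAction.fiber_ofAdd_one_pow (α : BundleAction E (Multiplicative (ZMod k))) (x : X) :
    α.fiber x (Multiplicative.ofAdd 1) ^ k = 1 := by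
  rw [← map_pow, ← ofAdd_nsmul]
  simp

theorem BundleAction.fiber_eq_pow [NeZero k] (α : BundleAction E (Multiplicative (ZMod k)))
    (x : X) (g : Multiplicative (ZMod k)) :
    α.fiber x g = α.fiber x (Multiplicative.ofAdd 1) ^ (g.toAdd).val := by
  rw [← map_pow, ← ofAdd_nsmul]
  simp

theorem BundleAction.IsImplementedAt.fiber_apply [NeZero k] (h : α.IsImplementedAt x v)
    (g : Multiplicative (ZMod k)) (a : E x) :
    α.fiber x g a = v ^ (g.toAdd).val * a * star (v ^ (g.toAdd).val) := by
  rw [α.fiber_eq_pow, StarAlgEquiv.pow_apply_of_conj h.2.2]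

theorem sum_zmod_val [NeZero k] {M : Type*} [AddCommMonoid M] (f : ℕ → M) :
    ∑ g : Multiplicative (ZMod k), f (g.toAdd).val = ∑ m ∈ Finset.range k, f m := by
  obtain _ | k := k
  · exact absurd rfl (NeZero.ne 0)
  · have h : ∑ g : Multiplicative (ZMod (k + 1)), f (g.toAdd).val = ∑ i : Fin (k + 1), f i :=
      Fintype.sum_equiv (Multiplicative.toAdd (α := ZMod (k + 1))) _ (fun i : Fin (k + 1) => f i)
        fun _ => rfl
    rw [h, Fin.sum_univ_eq_sum_range f (k + 1)]

variable [TopologicalSpace X]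

theorem IsMatrixBundle.exists_starAlgEquiv [IsMatrixBundle E] (x : X) :
    ∃ n : ℕ, 0 < n ∧ Nonempty (E x ≃⋆ₐ[ℂ] Matrix (Fin n) (Fin n) ℂ) := by
  obtain ⟨n, hn, e, hx, he⟩ := IsMatrixBundle.exists_trivialization (E := E) x
  obtain ⟨φ, -⟩ := he x hx
  exact ⟨n, hn, ⟨φ⟩⟩

theorem IsMatrixBundle.nontrivial [IsMatrixBundle E] (x : X) : Nontrivial (E x) := by
  obtain ⟨n, hn, ⟨φ⟩⟩ := IsMatrixBundle.exists_starAlgEquiv (E := E) x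
  have : NeZero n := ⟨hn.ne'⟩
  exact φ.surjective.nontrivial

/-- Evaluation of sections at `x`. -/
def SectionAlgebra.evalHom [IsMatrixBundle E] (x : X) : SectionAlgebra E →⋆ₐ[ℂ] E x where
  toFun s := s x
  map_one' := rfl
  map_mul' _ _ := rfl
  map_zero' := rfl
  map_add' _ _ := rfl
  commutes' _ := rfl
  map_star' _ := rfl

theorem SectionAlgebra.continuous_apply [IsMatrixBundle E] [CompactSpace X] (x : X) :
    Continuous fun s : SectionAlgebra E => s x :=
  AddMonoidHomClass.continuous_of_bound (SectionAlgebra.evalHom (E := E) x) 1 fun s => by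
    rw [one_mul]
    exact s.norm_apply_le x

theorem BundleAction.exists_isImplementedAt [IsMatrixBundle E] [NeZero k]
    (α : BundleAction E (Multiplicative (ZMod k))) (x : X) : ∃ v : E x, α.IsImplementedAt x v := by
  obtain ⟨n, hn, ⟨φ⟩⟩ := IsMatrixBundle.exists_starAlgEquiv (E := E) x
  have : NeZero n := ⟨hn.ne'⟩
  set β := (φ.symm.trans (α.fiber x (Multiplicative.ofAdd 1))).trans φ with hβ
  have hk : β ^ k = 1 := by
    ext1 a
    rw [hβ, StarAlgEquiv.conj_pow_apply, α.fiber_ofAdd_one_pow]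
    simp
  obtain ⟨v, hv, hvk, hva⟩ := exists_unitary_of_pow_eq_one hk
  refine ⟨φ.symm v, ?_, ?_, fun a => ?_⟩
  · rw [Unitary.mem_iff] at hv ⊢
    rw [← map_star, ← map_mul, ← map_mul, hv.1, hv.2, map_one]
    exact ⟨rfl, rfl⟩
  · rw [← map_pow, hvk, map_one]
  · have h1 := congrArg φ.symm (hva (φ a))
    simpa [hβ, map_star] using h1

theorem BundleAction.IsImplementedAt.spectrum_subset [IsMatrixBundle E]
    (h : α.IsImplementedAt x v) : spectrum ℂ v ⊆ {z : ℂ | z ^ k = 1} := by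
  have := IsMatrixBundle.nontrivial (E := E) x
  intro z hz
  have h1 := spectrum.pow_mem_pow v k hz
  rw [h.2.1, spectrum.one_eq] at h1
  exact h1

/-- If `z` is not an eigenvalue of `v`, the map `F ↦ ∑ₘ F(m)(x) (z⁻¹ v) ^ m` annihilates all
`(a ⊗ 1) δ(b)`, but it does not annihilate the function supported at the neutral element with
value `1`. -/
theorem BundleAction.IsImplementedAt.spectrum_eq_of_isFreeAction [IsMatrixBundle E]
    [CompactSpace X] [NeZero k] (h : α.IsImplementedAt x v) (hα : IsFreeAction α.onSections) :
    spectrum ℂ v = {z : ℂ | z ^ k = 1} := by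
  classical
  have := IsMatrixBundle.nontrivial (E := E) x
  refine h.spectrum_subset.antisymm fun z hz => mem_spectrum_of_eigenSum_ne_zero hz h.2.1 ?_
  intro h0
  let Φ : (Multiplicative (ZMod k) → SectionAlgebra E) →ₗ[ℂ] E x :=
    ∑ g : Multiplicative (ZMod k), ((LinearMap.mulRight ℂ ((z⁻¹ • v) ^ (g.toAdd).val)).comp
      ((SectionAlgebra.evalHom (E := E) x).toAlgHom.toLinearMap.comp (LinearMap.proj g)))
  have hΦ : ∀ F, Φ F = ∑ g : Multiplicative (ZMod k), F g x * (z⁻¹ • v) ^ (g.toAdd).val := by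
    intro F
    simp only [Φ, LinearMap.sum_apply]
    rfl
  have hcont : Continuous Φ := by
    have : (Φ : (Multiplicative (ZMod k) → SectionAlgebra E) → E x) =
        fun F => ∑ g : Multiplicative (ZMod k), F g x * (z⁻¹ • v) ^ (g.toAdd).val := funext hΦ
    rw [this]
    refine continuous_finsetSum _ fun g _ => Continuous.mul ?_ continuous_const
    exact (SectionAlgebra.continuous_apply x).comp (continuous_apply g)
  have hspan : ∀ F ∈ Submodule.span ℂ {F : Multiplicative (ZMod k) → SectionAlgebra E |
      ∃ a b, F = fun g => a * α.onSections g b}, Φ F = 0 := by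
    intro F hF
    rw [← LinearMap.mem_ker]
    refine Submodule.span_le.2 ?_ hF
    rintro _ ⟨a, b, rfl⟩
    rw [SetLike.mem_coe, LinearMap.mem_ker, hΦ]
    have h1 : ∀ g : Multiplicative (ZMod k), (a * α.onSections g b) x *
        (z⁻¹ • v) ^ (g.toAdd).val = a x * ((z⁻¹ • v) ^ (g.toAdd).val * b x) := by
      intro g
      change a x * α.fiber x g (b x) * _ = _
      rw [h.fiber_apply, smul_pow, mul_smul_comm, smul_mul_assoc, mul_smul_comm, mul_assoc,
        mul_assoc (v ^ _ * b x), Unitary.star_mul_self_of_mem (pow_mem h.1 _), mul_one]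
    simp only [h1]
    rw [← Finset.mul_sum, ← Finset.sum_mul, sum_zmod_val (fun m => (z⁻¹ • v) ^ m)]
    change a x * (eigenSum k z v * b x) = 0
    rw [h0, zero_mul, mul_zero]
  have hzero : ∀ F, Φ F = 0 := by
    have : (Φ : _ → E x) = fun _ => 0 :=
      Continuous.ext_on hα hcont continuous_const fun F hF => hspan F hF
    exact congrFun this
  have h1 := hzero (Pi.single 1 1)
  rw [hΦ, Finset.sum_eq_single 1] at h1
  · simp at h1
  · intro g _ hg
    rw [Pi.single_eq_of_ne hg, SectionAlgebra.zero_apply, zero_mul]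
  · simp

end Fibers

/-! ### Equivariant homomorphisms from the cone -/

section Extension

/-- Extension by zero of a function in `C₀((0, 1])`; it is continuous on `(-∞, 1]`. -/
noncomputable def coneExtend (f : C₀(Set.Ioc (0 : ℝ) 1, ℂ)) (r : ℝ) : ℂ :=
  open Classical in if h : r ∈ Set.Ioc (0 : ℝ) 1 then f ⟨r, h⟩ else 0

theorem coneExtend_of_nonpos (f : C₀(Set.Ioc (0 : ℝ) 1, ℂ)) {r : ℝ} (hr : r ≤ 0) :
    coneExtend f r = 0 :=
  dif_neg fun h => hr.not_gt h.1

theorem coneExtend_coneCoord {r : ℝ} (hr : r ∈ Set.Icc (0 : ℝ) 1) :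
    coneExtend coneCoord r = (r : ℂ) := by
  rcases hr.1.eq_or_lt with h | h
  · rw [coneExtend_of_nonpos _ h.symm.le, ← h, Complex.ofReal_zero]
  · exact dif_pos ⟨h, hr.2⟩

theorem coneExtend_add (f g : C₀(Set.Ioc (0 : ℝ) 1, ℂ)) (r : ℝ) :
    coneExtend (f + g) r = coneExtend f r + coneExtend g r := by
  unfold coneExtend; split_ifs <;> simp

theorem coneExtend_mul (f g : C₀(Set.Ioc (0 : ℝ) 1, ℂ)) (r : ℝ) :
    coneExtend (f * g) r = coneExtend f r * coneExtend g r := by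
  unfold coneExtend; split_ifs <;> simp

theorem coneExtend_smul (c : ℂ) (f : C₀(Set.Ioc (0 : ℝ) 1, ℂ)) (r : ℝ) :
    coneExtend (c • f) r = c * coneExtend f r := by
  unfold coneExtend; split_ifs <;> simp

theorem coneExtend_star (f : C₀(Set.Ioc (0 : ℝ) 1, ℂ)) (r : ℝ) :
    coneExtend (star f) r = star (coneExtend f r) := by
  unfold coneExtend; split_ifs <;> simp

theorem coneExtend_zero (r : ℝ) : coneExtend 0 r = 0 := by
  unfold coneExtend; split_ifs <;> simp

theorem continuousOn_coneExtend (f : C₀(Set.Ioc (0 : ℝ) 1, ℂ)) :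
    ContinuousOn (coneExtend f) (Set.Iic 1) := by
  intro r hr
  rcases lt_or_ge 0 r with h0 | h0
  · have h1 : ContinuousOn (coneExtend f) (Set.Ioc 0 1) := by
      rw [continuousOn_iff_continuous_domRestrict]
      refine (map_continuous f).congr fun t => ?_
      change f t = coneExtend f t
      rw [coneExtend, dif_pos t.2]
    refine (h1 r ⟨h0, hr⟩).mono_of_mem_nhdsWithin ?_
    rw [← Set.Ioi_inter_Iic, Set.inter_comm]
    exact inter_mem_nhdsWithin _ (Ioi_mem_nhds h0)
  · refine ContinuousAt.continuousWithinAt ?_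
    rw [ContinuousAt, coneExtend_of_nonpos f h0, Metric.tendsto_nhds]
    intro ε hε
    obtain ⟨K, hK, hKf⟩ := Filter.mem_cocompact.1
      ((Metric.tendsto_nhds.1 (zero_at_infty f)) ε hε)
    have hc : IsClosed (Subtype.val '' K : Set ℝ) := (hK.image continuous_subtype_val).isClosed
    have hr' : r ∉ (Subtype.val '' K : Set ℝ) := by
      rintro ⟨t, -, rfl⟩
      exact h0.not_gt t.2.1
    filter_upwards [hc.isOpen_compl.mem_nhds hr'] with s hs
    unfold coneExtend
    split_ifs with h
    · exact hKf fun hK' => hs ⟨_, hK', rfl⟩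
    · rwa [dist_self]

end Extension

section ConeHom

variable {G : Type*} [Group G] {A : Type*} [CStarAlgebra A]

/-- A homomorphism `σ` from the cone over a point whose image is orthogonal to its nontrivial
translates generates an equivariant homomorphism from `C₀((0, 1]) ⊗ C(G)`. -/
theorem exists_equivariant_of_orthogonal [Fintype G] (α : G →* (A ≃⋆ₐ[ℂ] A))
    (σ : C₀(Set.Ioc (0 : ℝ) 1, ℂ) →⋆ₙₐ[ℂ] A)
    (hσ : ∀ g ≠ 1, ∀ f f', α g (σ f) * σ f' = 0) :
    ∃ ρ : ConeAlgebra G →⋆ₙₐ[ℂ] A, (∀ h F, ρ (ConeAlgebra.translate h F) = α h (ρ F)) ∧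
      ρ (fun _ => coneCoord) = ∑ g, α g (σ coneCoord) := by
  classical
  have hmul : ∀ g h : G, ∀ a b : A, α g a = α h (α (h⁻¹ * g) a) := by
    intro g h a _
    change _ = (α h * α (h⁻¹ * g)) a
    rw [← map_mul, mul_inv_cancel_left]
  refine ⟨{ toFun := fun F => ∑ g, α g⁻¹ (σ (F g))
            map_smul' := fun c F => ?_
            map_zero' := ?_
            map_add' := fun F F' => ?_
            map_mul' := fun F F' => ?_
            map_star' := fun F => ?_ }, fun h F => ?_, ?_⟩
  · simp [Finset.smul_sum]
  · simp
  · simp [Finset.sum_add_distrib]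
  · rw [Finset.sum_mul_sum]
    refine Finset.sum_congr rfl fun g _ => ?_
    rw [Finset.sum_eq_single g]
    · rw [Pi.mul_apply, map_mul, map_mul]
    · intro h _ hg
      rw [hmul g⁻¹ h⁻¹ _ (σ (F' h)), ← map_mul, hσ _ _ _ _, map_zero]
      rw [inv_inv, Ne, mul_inv_eq_one]
      exact hg
    · simp
  · simp [star_sum, map_star]
  · change ∑ g, α g⁻¹ (σ (F (g * h))) = α h (∑ g, α g⁻¹ (σ (F g)))
    rw [map_sum]
    refine Fintype.sum_equiv (Equiv.mulRight h) _ _ fun g => ?_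
    rw [hmul g⁻¹ h _ 0, Equiv.coe_mulRight, mul_inv_rev]
  · exact Fintype.sum_equiv (Equiv.inv G) _ _ fun g => rfl

/-- Sums `∑ ρⱼ(t ⊗ 1)` over finite families of equivariant `*`-homomorphisms `ρⱼ` from
`C₀((0, 1]) ⊗ C(G)`. -/
def IsConeSum (α : G →* (A ≃⋆ₐ[ℂ] A)) (a : A) : Prop :=
  ∃ (n : ℕ) (ρ : Fin n → (ConeAlgebra G →⋆ₙₐ[ℂ] A)),
    (∀ j h F, ρ j (ConeAlgebra.translate h F) = α h (ρ j F)) ∧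
      ∑ j, ρ j (fun _ => coneCoord) = a

variable {α : G →* (A ≃⋆ₐ[ℂ] A)} {a b : A}

theorem IsConeSum.zero : IsConeSum α 0 := ⟨0, Fin.elim0, fun j => j.elim0, by simp⟩

theorem IsConeSum.single {ρ : ConeAlgebra G →⋆ₙₐ[ℂ] A}
    (hρ : ∀ h F, ρ (ConeAlgebra.translate h F) = α h (ρ F)) :
    IsConeSum α (ρ fun _ => coneCoord) :=
  ⟨1, fun _ => ρ, fun _ => hρ, by simp⟩

theorem IsConeSum.add (ha : IsConeSum α a) (hb : IsConeSum α b) : IsConeSum α (a + b) := by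
  obtain ⟨n, ρ, hρ, rfl⟩ := ha
  obtain ⟨m, τ, hτ, rfl⟩ := hb
  refine ⟨n + m, Fin.append ρ τ, fun j h F => ?_, ?_⟩
  · induction j using Fin.addCases with
    | left i => simpa using hρ i h F
    | right i => simpa using hτ i h F
  · simp [Fin.sum_univ_add]

theorem IsConeSum.sum {ι : Type*} (s : Finset ι) {a : ι → A} (h : ∀ i ∈ s, IsConeSum α (a i)) :
    IsConeSum α (∑ i ∈ s, a i) :=
  Finset.sum_induction _ _ (fun _ _ => IsConeSum.add) IsConeSum.zero h

theorem IsConeSum.exists_isWeakLTAdmissible (ha : IsConeSum α a) (hu : IsUnit a) :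
    ∃ n, IsWeakLTAdmissible α n := by
  obtain ⟨n, ρ, hρ, rfl⟩ := ha
  -- The zero homomorphism is added because a family indexed by `Fin (n + 1)` is nonempty.
  refine ⟨n, Fin.cons 0 ρ, fun j h F => ?_, ?_⟩
  · refine Fin.cases ?_ (fun i => ?_) j
    · simp
    · simpa using hρ i h F
  · simpa [Fin.sum_univ_succ] using hu

end ConeHom

/-! ### Compactness of the base -/

section Compactness

-- The fibers carry no order of their own; positivity refers to the spectral order.
attribute [local instance] CStarAlgebra.spectralOrder CStarAlgebra.spectralOrderedRing

theorem isUnit_add_of_nonneg {A : Type*} [CStarAlgebra A] {a b : A} (ha : 0 ≤ a) (hb : 0 ≤ b)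
    (h : IsUnit a) : IsUnit (a + b) :=
  CStarAlgebra.isUnit_of_le a (le_add_of_nonneg_right hb) (h.isStrictlyPositive ha)

variable {X : Type*} [TopologicalSpace X] {E : X → Type*} [∀ x, CStarAlgebra (E x)]
  [TopologicalSpace (TotalSpace Unit E)] [IsMatrixBundle E]

theorem IsConeSum.apply_nonneg [CompactSpace X] {G : Type*} [Group G]
    {α : G →* (SectionAlgebra E ≃⋆ₐ[ℂ] SectionAlgebra E)} {a : SectionAlgebra E}
    (ha : IsConeSum α a) (x : X) : 0 ≤ a x := by
  obtain ⟨n, ρ, -, rfl⟩ := ha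
  change 0 ≤ SectionAlgebra.evalHom x (∑ j, ρ j fun _ => coneCoord)
  rw [map_sum]
  refine Finset.sum_nonneg fun j _ => ?_
  have h : (fun _ => coneCoord : ConeAlgebra G) = star (fun _ => coneSqrt) * fun _ => coneSqrt := by
    funext g
    change coneCoord = star coneSqrt * coneSqrt
    rw [star_coneSqrt, coneSqrt_mul_self]
  rw [h, map_mul, map_mul, map_star, map_star]
  exact star_mul_self_nonneg _

open scoped Matrix.Norms.L2Operator in
theorem SectionAlgebra.isOpen_setOf_isUnit_apply (s : SectionAlgebra E) :
    IsOpen {x | IsUnit (s x)} := by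
  rw [isOpen_iff_mem_nhds]
  intro x₀ hx₀
  obtain ⟨n, -, e, hx, he⟩ := IsMatrixBundle.exists_trivialization (E := E) x₀
  have h1 : IsUnit (e ⟨x₀, s x₀⟩).2 := by
    obtain ⟨φ, hφ⟩ := he x₀ hx
    rw [hφ]
    exact hx₀.map φ
  filter_upwards [eventually_baseSet hx,
    (s.isContSection.local hx).eventually (Units.isOpen.mem_nhds h1)] with x hx' hu
  obtain ⟨φ, hφ⟩ := he x hx'
  change IsUnit (e ⟨x, s x⟩).2 at hu
  rw [hφ] at hu
  simpa using hu.map φ.symm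

open scoped Matrix.Norms.L2Operator in
theorem SectionAlgebra.isUnit_of_forall_isUnit_apply {s : SectionAlgebra E}
    (h : ∀ x, IsUnit (s x)) : IsUnit s := by
  have hc : IsContSection fun x => Ring.inverse (s x) := .of_local fun x₀ n e hx he => by
    have key : ∀ x ∈ e.baseSet, IsUnit (e ⟨x, s x⟩).2 ∧
        (e ⟨x, Ring.inverse (s x)⟩).2 = Ring.inverse (e ⟨x, s x⟩).2 := by
      intro x hx'
      obtain ⟨φ, hφ⟩ := he x hx'
      simp only [hφ]
      obtain ⟨u, hu⟩ := h x
      rw [← hu]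
      have h2 : φ u = (Units.map (φ : E x →* Matrix (Fin n) (Fin n) ℂ) u : _) := rfl
      rw [Ring.inverse_unit, h2, Ring.inverse_unit]
      exact ⟨Units.isUnit _, rfl⟩
    obtain ⟨u, hu⟩ := (key x₀ hx).1
    have h3 := NormedRing.inverse_continuousAt u
    rw [hu] at h3
    refine (ContinuousAt.comp (f := fun x => (e ⟨x, s x⟩).2) h3 (s.isContSection.local hx)).congr ?_
    filter_upwards [eventually_baseSet hx] with x hx'
    exact (key x hx').2.symm
  refine isUnit_iff_exists.2 ⟨SectionAlgebra.mk _ hc, ?_, ?_⟩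
  · ext x
    exact Ring.mul_inverse_cancel _ (h x)
  · ext x
    exact Ring.inverse_mul_cancel _ (h x)

theorem exists_isWeakLTAdmissible_of_forall_isUnit_apply [CompactSpace X] {G : Type*} [Group G]
    {α : G →* (SectionAlgebra E ≃⋆ₐ[ℂ] SectionAlgebra E)}
    (h : ∀ x, ∃ a, IsConeSum α a ∧ IsUnit (a x)) : ∃ n, IsWeakLTAdmissible α n := by
  obtain ⟨a, ha, hu⟩ : ∃ a, IsConeSum α a ∧ ∀ x ∈ Set.univ, IsUnit (a x) := by
    refine isCompact_univ.induction_on (p := fun s => ∃ a, IsConeSum α a ∧ ∀ x ∈ s, IsUnit (a x))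
      ⟨0, IsConeSum.zero, by simp⟩ ?_ ?_ ?_
    · rintro s t hst ⟨a, ha, hu⟩
      exact ⟨a, ha, fun x hx => hu x (hst hx)⟩
    · rintro s t ⟨a, ha, hau⟩ ⟨b, hb, hbu⟩
      refine ⟨a + b, ha.add hb, fun x hx => ?_⟩
      rcases hx with hx | hx
      · exact isUnit_add_of_nonneg (ha.apply_nonneg x) (hb.apply_nonneg x) (hau x hx)
      · rw [SectionAlgebra.add_apply, add_comm]
        exact isUnit_add_of_nonneg (hb.apply_nonneg x) (ha.apply_nonneg x) (hbu x hx)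
    · intro x _
      obtain ⟨a, ha, hu⟩ := h x
      exact ⟨_, mem_nhdsWithin_of_mem_nhds (a.isOpen_setOf_isUnit_apply.mem_nhds hu), a, ha,
        fun y hy => hy⟩
  exact ha.exists_isWeakLTAdmissible
    (SectionAlgebra.isUnit_of_forall_isUnit_apply fun x => hu x (Set.mem_univ x))

end Compactness

/-! ### Homomorphisms from the cone supported near a point -/

section LocalHom

variable {X : Type*} [TopologicalSpace X] {E : X → Type*} [∀ x, CStarAlgebra (E x)]
  [TopologicalSpace (TotalSpace Unit E)] [IsMatrixBundle E]

theorem IsContSection.smul_of_tsupport {c : X → ℂ} (hc : Continuous c) {Q : ∀ x, E x}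
    (hQ : ∀ x ∈ tsupport c, ContinuousAt (fun x => (⟨x, Q x⟩ : TotalSpace Unit E)) x) :
    IsContSection fun x => c x • Q x := .of_local fun x₀ n e hx he => by
  by_cases h : x₀ ∈ tsupport c
  · refine (hc.continuousAt.smul ((continuousAt_section_iff hx).1 (hQ x₀ h))).congr ?_
    filter_upwards [eventually_baseSet hx] with x hx'
    obtain ⟨φ, hφ⟩ := he x hx'
    simp [hφ]
  · refine (continuousAt_const (y := (0 : Matrix (Fin n) (Fin n) ℂ))).congr ?_
    filter_upwards [eventually_baseSet hx, (isClosed_tsupport c).isOpen_compl.mem_nhds h]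
      with x hx' hxc
    obtain ⟨φ, hφ⟩ := he x hx'
    rw [hφ, image_eq_zero_of_notMem_tsupport hxc, zero_smul, map_zero]

/-- A continuous field `Q` of projections on the support of `χ : X → [0, 1]`, orthogonal to its
nontrivial translates, gives the equivariant homomorphism `f ⊗ δ₁ ↦ f(χ) Q`. -/
theorem isConeSum_of_projections [CompactSpace X] {G : Type*} [Group G] [Fintype G]
    (α : BundleAction E G) (χ : C(X, ℝ)) (hχ : ∀ x, χ x ∈ Set.Icc (0 : ℝ) 1) {Q : ∀ x, E x}
    (hQ : ∀ x ∈ tsupport χ, ContinuousAt (fun x => (⟨x, Q x⟩ : TotalSpace Unit E)) x ∧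
      star (Q x) = Q x ∧ Q x * Q x = Q x ∧ ∀ g ≠ 1, α.fiber x g (Q x) * Q x = 0) :
    ∃ a, IsConeSum α.onSections a ∧ ∀ x, a x = (χ x : ℂ) • ∑ g, α.fiber x g (Q x) := by
  have hcont : ∀ f, Continuous fun x => coneExtend f (χ x) := fun f =>
    (continuousOn_coneExtend f).comp_continuous χ.continuous fun x => (hχ x).2
  have hzero : ∀ f x, x ∉ tsupport χ → coneExtend f (χ x) = 0 := by
    intro f x hx
    rw [image_eq_zero_of_notMem_tsupport hx]
    exact coneExtend_of_nonpos f le_rfl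
  have hsupp : ∀ f, tsupport (fun x => coneExtend f (χ x)) ⊆ tsupport χ := by
    intro f
    refine closure_minimal (fun x hx => ?_) (isClosed_tsupport _)
    by_contra h
    exact hx (hzero f x h)
  let σ : C₀(Set.Ioc (0 : ℝ) 1, ℂ) →⋆ₙₐ[ℂ] SectionAlgebra E :=
    { toFun := fun f => SectionAlgebra.mk (fun x => coneExtend f (χ x) • Q x)
        (.smul_of_tsupport (hcont f) fun x hx => (hQ x (hsupp f hx)).1)
      map_smul' := fun c f => by
        ext x
        simp [coneExtend_smul, mul_smul]
      map_zero' := by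
        ext x
        simp [coneExtend_zero]
      map_add' := fun f g => by
        ext x
        simp [coneExtend_add, add_smul]
      map_mul' := fun f g => by
        ext x
        by_cases hx : x ∈ tsupport χ
        · rw [SectionAlgebra.mul_apply, SectionAlgebra.mk_apply, SectionAlgebra.mk_apply,
            SectionAlgebra.mk_apply, smul_mul_smul_comm, coneExtend_mul, (hQ x hx).2.2.1]
        · simp [hzero _ x hx]
      map_star' := fun f => by
        ext x
        by_cases hx : x ∈ tsupport χ
        · simp [coneExtend_star, (hQ x hx).2.1]
        · simp [hzero _ x hx] }
  have hσ : ∀ f x, σ f x = coneExtend f (χ x) • Q x := fun _ _ => rfl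
  obtain ⟨ρ, hρ, h⟩ := exists_equivariant_of_orthogonal α.onSections σ fun g hg f f' => by
    ext x
    change α.fiber x g (σ f x) * σ f' x = 0
    rw [hσ, hσ]
    by_cases hx : x ∈ tsupport χ
    · rw [map_smul, smul_mul_smul_comm, (hQ x hx).2.2.2 g hg, smul_zero]
    · rw [hzero f' x hx, zero_smul, mul_zero]
  refine ⟨_, IsConeSum.single hρ, fun x => ?_⟩
  rw [h]
  change SectionAlgebra.evalHom x (∑ g, α.onSections g (σ coneCoord)) = _
  rw [map_sum, Finset.smul_sum]
  refine Finset.sum_congr rfl fun g _ => ?_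
  change α.fiber x g (σ coneCoord x) = _
  rw [hσ, map_smul, coneExtend_coneCoord (hχ x)]

end LocalHom

/-! ### Projections near a point with full spectrum -/

section LocalUnitary

open Filter Topology Matrix

variable {n k : ℕ} [NeZero k]

/-- Near a point, a continuous family of automorphisms of order dividing `k` is implemented by
a continuous family of unitaries of order dividing `k`: rescale the intertwiners `T y` by a branch
of the `k`-th root, where the scalar `(T y) ^ k` is close to `1`. -/
theorem exists_local_unitary [NeZero n] {Y : Type*} [TopologicalSpace Y] {x₀ : Y}
    {β : Y → (Matrix (Fin n) (Fin n) ℂ ≃⋆ₐ[ℂ] Matrix (Fin n) (Fin n) ℂ)}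
    (hc : ∀ᶠ y in 𝓝 x₀, ∀ a, ContinuousAt (fun y => β y a) y) (hβ : ∀ y, β y ^ k = 1)
    {v : Matrix (Fin n) (Fin n) ℂ} (hv : v ∈ unitary (Matrix (Fin n) (Fin n) ℂ))
    (hvk : v ^ k = 1) (hβv : ∀ a, β x₀ a = v * a * star v) :
    ∃ V : Y → Matrix (Fin n) (Fin n) ℂ, V x₀ = v ∧ ∀ᶠ y in 𝓝 x₀, ContinuousAt V y ∧
      V y ∈ unitary (Matrix (Fin n) (Fin n) ℂ) ∧ V y ^ k = 1 ∧
      ∀ a, β y a = V y * a * star (V y) := by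
  set T : Y → Matrix (Fin n) (Fin n) ℂ := fun y => intertwiner (β y) v with hT
  have hT0 : T x₀ = v := intertwiner_self hv hβv
  have hTc : ∀ᶠ y in 𝓝 x₀, ContinuousAt T y := by
    filter_upwards [hc] with y hy
    exact tendsto_finsetSum _ fun i _ => ((hy _).mul continuousAt_const).mul continuousAt_const
  set Λ : Y → ℂ := fun y => (T y ^ k) 0 0 with hΛ
  have hΛ0 : Λ x₀ = 1 := by simp [hΛ, hT0, hvk]
  have hΛc : ∀ᶠ y in 𝓝 x₀, ContinuousAt Λ y := by
    filter_upwards [hTc] with y hy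
    exact (continuous_id.matrix_elem 0 0).continuousAt.comp (hy.pow k)
  have hslit : ∀ᶠ y in 𝓝 x₀, Λ y ∈ Complex.slitPlane :=
    hΛc.self_of_nhds.eventually
      (Complex.isOpen_slitPlane.mem_nhds (by rw [hΛ0]; exact Complex.one_mem_slitPlane))
  refine ⟨fun y => (Λ y ^ ((k : ℂ)⁻¹))⁻¹ • T y, by simp [hΛ0, hT0], ?_⟩
  filter_upwards [hTc, hΛc, hslit] with y h1 h2 h3
  have hne : Λ y ≠ 0 := Complex.slitPlane_ne_zero h3
  have hTy := intertwiner_mul (β y) v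
  have hTne : T y ≠ 0 := by
    intro h
    apply hne
    simp [hΛ, h, NeZero.ne k]
  have hpow := inv_smul_pow_eq_one_of_intertwines hTy (hβ y) hTne
    (Complex.cpow_nat_inv_pow (Λ y) (NeZero.ne k))
  obtain ⟨h4, h5⟩ := unitary_of_intertwines (smul_intertwines hTy _) hpow
  refine ⟨?_, h4, hpow, h5⟩
  refine ((h2.cpow continuousAt_const h3).inv₀ ?_).smul h1
  rw [Ne, Complex.cpow_eq_zero_iff]
  exact fun h => hne h.1

end LocalUnitary

section CyclicVector

open Filter Topology Matrix

variable {n : ℕ}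

theorem IsPrimitiveRoot.pow_pow_eq_one {k : ℕ} {ω : ℂ} (hω : IsPrimitiveRoot ω k) (j : ℕ) :
    (ω ^ j) ^ k = 1 := by
  rw [← pow_mul, mul_comm, pow_mul, hω.pow_eq_one, one_pow]

theorem conj_vecMulVec_star (W : Matrix (Fin n) (Fin n) ℂ) (f : Fin n → ℂ) :
    W * vecMulVec f (star f) * star W = vecMulVec (W *ᵥ f) (star (W *ᵥ f)) := by
  rw [mul_vecMulVec, vecMulVec_mul, star_mulVec, star_eq_conjTranspose]

/-- If only `0` is orthogonal to the orbits of the vectors `f s` under the powers of `V`, then the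
translates of the rank-one operators `f s (f s)*` have an invertible sum. -/
theorem isUnit_sum_conj_vecMulVec {k : ℕ} {V : Matrix (Fin n) (Fin n) ℂ}
    {ι : Type*} [Fintype ι] {f : ι → Fin n → ℂ}
    (hspan : ∀ ξ : Fin n → ℂ, (∀ s, ∀ m < k, star (V ^ m *ᵥ f s) ⬝ᵥ ξ = 0) → ξ = 0) :
    IsUnit (∑ s, ∑ m ∈ Finset.range k, V ^ m * vecMulVec (f s) (star (f s)) * star (V ^ m)) := by
  rw [← mulVec_injective_iff_isUnit]
  -- The quadratic form of the sum at `ξ` is `∑ |⟨V ^ m f s, ξ⟩| ^ 2`.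
  simp only [conj_vecMulVec_star]
  refine (injective_iff_map_eq_zero (Matrix.mulVecLin (∑ s, ∑ m ∈ Finset.range k,
      vecMulVec (V ^ m *ᵥ f s) (star (V ^ m *ᵥ f s))))).2 fun ξ hξ => hspan ξ ?_
  rw [mulVecLin_apply] at hξ
  have h1 : star ξ ⬝ᵥ ((∑ s, ∑ m ∈ Finset.range k,
      vecMulVec (V ^ m *ᵥ f s) (star (V ^ m *ᵥ f s))) *ᵥ ξ) =
      ((∑ s, ∑ m ∈ Finset.range k, ‖star (V ^ m *ᵥ f s) ⬝ᵥ ξ‖ ^ 2 : ℝ) : ℂ) := by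
    simp only [sum_mulVec, dotProduct_sum, Complex.ofReal_sum]
    refine Finset.sum_congr rfl fun s _ => Finset.sum_congr rfl fun m _ => ?_
    rw [vecMulVec_mulVec, op_smul_eq_smul, dotProduct_smul, smul_eq_mul, Complex.ofReal_pow,
      ← Complex.mul_conj', ← Complex.star_def, star_dotProduct, star_star]
  rw [hξ, dotProduct_zero] at h1
  have h2 : ∑ s, ∑ m ∈ Finset.range k, ‖star (V ^ m *ᵥ f s) ⬝ᵥ ξ‖ ^ 2 = 0 := by
    exact_mod_cast h1.symm
  intro s m hm
  rw [Finset.sum_eq_zero_iff_of_nonneg fun _ _ => Finset.sum_nonneg fun _ _ => by positivity] at h2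
  have h3 := h2 s (Finset.mem_univ s)
  rw [Finset.sum_eq_zero_iff_of_nonneg fun _ _ => by positivity] at h3
  simpa using h3 m (Finset.mem_range.2 hm)

theorem continuous_eigenSum (k : ℕ) (z : ℂ) :
    Continuous fun V : Matrix (Fin n) (Fin n) ℂ => eigenSum k z V := by
  unfold eigenSum
  fun_prop

variable {k : ℕ} [NeZero k]

theorem mulVec_eigenSum_mulVec {z : ℂ} {V : Matrix (Fin n) (Fin n) ℂ} (hz : z ^ k = 1)
    (hV : V ^ k = 1) (ξ : Fin n → ℂ) :
    V *ᵥ (eigenSum k z V *ᵥ ξ) = z • (eigenSum k z V *ᵥ ξ) := by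
  rw [mulVec_mulVec, mul_eigenSum hz hV, smul_mulVec]

theorem pow_mulVec_of_mulVec_eq {V : Matrix (Fin n) (Fin n) ℂ} {ζ : ℂ} {e : Fin n → ℂ}
    (h : V *ᵥ e = ζ • e) (m : ℕ) : V ^ m *ᵥ e = ζ ^ m • e := by
  induction m with
  | zero => simp
  | succ m ih => rw [pow_succ, ← mulVec_mulVec, h, mulVec_smul, ih, smul_smul, pow_succ']

theorem dotProduct_mulVec_of_unitary {V : Matrix (Fin n) (Fin n) ℂ}
    (hV : V ∈ unitary (Matrix (Fin n) (Fin n) ℂ)) (a b : Fin n → ℂ) :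
    star (V *ᵥ a) ⬝ᵥ (V *ᵥ b) = star a ⬝ᵥ b := by
  rw [star_mulVec, dotProduct_mulVec, vecMul_vecMul, ← star_eq_conjTranspose,
    Unitary.star_mul_self_of_mem hV, vecMul_one]

theorem dotProduct_eq_zero_of_eigenvectors {V : Matrix (Fin n) (Fin n) ℂ}
    (hV : V ∈ unitary (Matrix (Fin n) (Fin n) ℂ)) {ζ η : ℂ} (hζ : ζ ^ k = 1) (h : ζ ≠ η)
    {a b : Fin n → ℂ} (ha : V *ᵥ a = ζ • a) (hb : V *ᵥ b = η • b) : star a ⬝ᵥ b = 0 := by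
  have h1 := dotProduct_mulVec_of_unitary hV a b
  have hn : star ζ * ζ = 1 := by
    rw [Complex.star_def, Complex.conj_mul', Complex.norm_eq_one_of_pow_eq_one hζ (NeZero.ne k)]
    simp
  rw [ha, hb, star_smul, smul_dotProduct, dotProduct_smul, smul_smul, smul_eq_mul] at h1
  have h2 : (star ζ * (η - ζ)) * (star a ⬝ᵥ b) = 0 := by
    linear_combination h1 - (star a ⬝ᵥ b) * hn
  refine (mul_eq_zero.1 h2).resolve_left (mul_ne_zero ?_ (sub_ne_zero.2 h.symm))
  rintro h3
  rw [h3, zero_mul] at hn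
  exact zero_ne_one hn

/-- The squared Euclidean norm of a vector. -/
noncomputable def normSqVec (e : Fin n → ℂ) : ℝ := ∑ i, ‖e i‖ ^ 2

theorem star_dotProduct_self (e : Fin n → ℂ) : star e ⬝ᵥ e = (normSqVec e : ℂ) := by
  simp [normSqVec, dotProduct, Complex.conj_mul']

theorem normSqVec_pos {e : Fin n → ℂ} (h : e ≠ 0) : 0 < normSqVec e := by
  obtain ⟨i, hi⟩ := Function.ne_iff.1 h
  refine Finset.sum_pos' (fun _ _ => by positivity) ⟨i, Finset.mem_univ i, ?_⟩
  have : ‖e i‖ ≠ 0 := norm_ne_zero_iff.2 hi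
  positivity

/-- For a primitive `k`-th root of unity `ω`, a unitary `V` with `V ^ k = 1` and vectors `ε j` with
nonzero projections to the eigenspaces at `ω ^ j`: the unit vector with equal weights `1 / k` in all
eigenspaces whose component at `ω ^ j` is a positive multiple of the projection of `ε j`. Its
translates under `V ^ m`, `m < k`, are orthonormal. -/
noncomputable def cyclicVector (ω : ℂ) (ε : Fin k → Fin n → ℂ) (V : Matrix (Fin n) (Fin n) ℂ) :
    Fin n → ℂ :=
  ∑ j : Fin k, ((√(k * normSqVec (eigenSum k (ω ^ (j : ℕ)) V *ᵥ ε j)) : ℝ) : ℂ)⁻¹ •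
    (eigenSum k (ω ^ (j : ℕ)) V *ᵥ ε j)

theorem sqrt_normSqVec_ne_zero {e : Fin n → ℂ} (h : e ≠ 0) :
    ((√(k * normSqVec e) : ℝ) : ℂ) ≠ 0 := by
  have h1 := normSqVec_pos h
  have h2 : (0 : ℝ) < k := Nat.cast_pos.2 (NeZero.pos k)
  exact Complex.ofReal_ne_zero.2 (Real.sqrt_pos.2 (mul_pos h2 h1)).ne'

theorem continuousAt_cyclicVector {ω : ℂ} {ε : Fin k → Fin n → ℂ}
    {V₀ : Matrix (Fin n) (Fin n) ℂ} (h : ∀ j : Fin k, eigenSum k (ω ^ (j : ℕ)) V₀ *ᵥ ε j ≠ 0) :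
    ContinuousAt (cyclicVector ω ε) V₀ := by
  refine tendsto_finsetSum _ fun j _ => ?_
  have h1 : Continuous fun V : Matrix (Fin n) (Fin n) ℂ => eigenSum k (ω ^ (j : ℕ)) V *ᵥ ε j :=
    (continuous_eigenSum k _).matrix_mulVec continuous_const
  have h2 : Continuous fun e : Fin n → ℂ => normSqVec e := by
    unfold normSqVec
    fun_prop
  have h3 : Continuous fun V : Matrix (Fin n) (Fin n) ℂ =>
      ((√(k * normSqVec (eigenSum k (ω ^ (j : ℕ)) V *ᵥ ε j)) : ℝ) : ℂ) :=
    Complex.continuous_ofReal.comp (Real.continuous_sqrt.comp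
      (continuous_const.mul (h2.comp h1)))
  exact (h3.continuousAt.inv₀ (sqrt_normSqVec_ne_zero (h j))).smul h1.continuousAt

variable {ω : ℂ} {ε : Fin k → Fin n → ℂ} {V : Matrix (Fin n) (Fin n) ℂ}

theorem star_cyclicVector_dotProduct_pow_mulVec (hω : IsPrimitiveRoot ω k)
    (hV : V ∈ unitary (Matrix (Fin n) (Fin n) ℂ)) (hVk : V ^ k = 1)
    (h : ∀ j : Fin k, eigenSum k (ω ^ (j : ℕ)) V *ᵥ ε j ≠ 0) {m : ℕ} (hm : m < k) :
    star (cyclicVector ω ε V) ⬝ᵥ (V ^ m *ᵥ cyclicVector ω ε V) = if m = 0 then 1 else 0 := by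
  set w : Fin k → Fin n → ℂ := fun j => eigenSum k (ω ^ (j : ℕ)) V *ᵥ ε j with hw
  set c : Fin k → ℂ := fun j => ((√(k * normSqVec (w j)) : ℝ) : ℂ)⁻¹ with hc
  have hf : cyclicVector ω ε V = ∑ j, c j • w j := rfl
  have hk0 : (k : ℂ) ≠ 0 := Nat.cast_ne_zero.2 (NeZero.ne k)
  have heig : ∀ j, V *ᵥ w j = ω ^ (j : ℕ) • w j := fun j =>
    mulVec_eigenSum_mulVec (hω.pow_pow_eq_one j) hVk _
  have hcw : ∀ j, star (c j) * (c j * (normSqVec (w j) : ℂ)) = (k : ℂ)⁻¹ := by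
    intro j
    have h1 := normSqVec_pos (h j)
    have h2 : (normSqVec (w j) : ℂ) ≠ 0 := Complex.ofReal_ne_zero.2 h1.ne'
    have h3 : ((√(k * normSqVec (w j)) : ℝ) : ℂ) * ((√(k * normSqVec (w j)) : ℝ) : ℂ) =
        k * normSqVec (w j) := by
      rw [← Complex.ofReal_mul, Real.mul_self_sqrt (by positivity)]
      push_cast
      rfl
    have h4 : star (c j) = c j := by
      simp [hc]
    rw [h4, ← mul_assoc, hc]
    change (_)⁻¹ * (_)⁻¹ * _ = _
    rw [← mul_inv, h3, mul_inv, mul_assoc, inv_mul_cancel₀ h2, mul_one]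
  have hsum : star (cyclicVector ω ε V) ⬝ᵥ (V ^ m *ᵥ cyclicVector ω ε V) =
      ∑ j : Fin k, (ω ^ m) ^ (j : ℕ) * (k : ℂ)⁻¹ := by
    rw [hf, star_sum, sum_dotProduct]
    refine Finset.sum_congr rfl fun j _ => ?_
    rw [mulVec_sum, dotProduct_sum, Finset.sum_eq_single j]
    · rw [mulVec_smul, pow_mulVec_of_mulVec_eq (heig j), star_smul, smul_dotProduct,
        dotProduct_smul, dotProduct_smul, star_dotProduct_self, ← hcw j, ← pow_mul, ← pow_mul,
        mul_comm m]
      simp only [smul_eq_mul]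
      ring
    · intro i _ hi
      rw [mulVec_smul, pow_mulVec_of_mulVec_eq (heig i), star_smul, smul_dotProduct,
        dotProduct_smul, dotProduct_smul, dotProduct_eq_zero_of_eigenvectors hV
          (hω.pow_pow_eq_one j) (fun hij => hi ?_) (heig j) (heig i)]
      · simp
      · exact Fin.ext (hω.pow_inj i.2 j.2 hij.symm)
    · simp
  rw [hsum, ← Finset.sum_mul, Fin.sum_univ_eq_sum_range (fun j => (ω ^ m) ^ j) k]
  split_ifs with h0
  · simp [h0, hk0]
  · have h1 : ω ^ m ≠ 1 := hω.pow_ne_one_of_pos_of_lt h0 hm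
    rw [geom_sum_eq h1, hω.pow_pow_eq_one, sub_self, zero_div, zero_mul]

theorem eigenSum_mulVec_of_mulVec_eq {z ζ : ℂ} {e : Fin n → ℂ} (hz : z ^ k = 1)
    (hζ : ζ ^ k = 1) (h : V *ᵥ e = ζ • e) :
    eigenSum k z V *ᵥ e = if ζ = z then (k : ℂ) • e else 0 := by
  have hz0 : z ≠ 0 := by
    rintro rfl
    simp [NeZero.ne k] at hz
  have h1 : eigenSum k z V *ᵥ e = (∑ m ∈ Finset.range k, (z⁻¹ * ζ) ^ m) • e := by
    rw [eigenSum, sum_mulVec, Finset.sum_smul]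
    refine Finset.sum_congr rfl fun m _ => ?_
    rw [smul_pow, smul_mulVec, pow_mulVec_of_mulVec_eq h, smul_smul, mul_pow]
  rw [h1]
  split_ifs with h2
  · simp [h2, hz0]
  · have h3 : z⁻¹ * ζ ≠ 1 := by
      rw [Ne, inv_mul_eq_one₀ hz0]
      exact fun h => h2 h.symm
    rw [geom_sum_eq h3, mul_pow, inv_pow, hz, hζ]
    simp

/-- A vector orthogonal to the orbit of the cyclic vector is orthogonal to its components in all
eigenspaces. -/
theorem star_eigenSum_mulVec_dotProduct_eq_zero (hω : IsPrimitiveRoot ω k) (hVk : V ^ k = 1)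
    (h : ∀ j : Fin k, eigenSum k (ω ^ (j : ℕ)) V *ᵥ ε j ≠ 0) {ξ : Fin n → ℂ}
    (hξ : ∀ m < k, star (V ^ m *ᵥ cyclicVector ω ε V) ⬝ᵥ ξ = 0) (j : Fin k) :
    star (eigenSum k (ω ^ (j : ℕ)) V *ᵥ ε j) ⬝ᵥ ξ = 0 := by
  set w : Fin k → Fin n → ℂ := fun j => eigenSum k (ω ^ (j : ℕ)) V *ᵥ ε j with hw
  set c : Fin k → ℂ := fun j => ((√(k * normSqVec (w j)) : ℝ) : ℂ)⁻¹ with hc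
  have hf : cyclicVector ω ε V = ∑ j, c j • w j := rfl
  have hk0 : (k : ℂ) ≠ 0 := Nat.cast_ne_zero.2 (NeZero.ne k)
  have heig : ∀ j, V *ᵥ w j = ω ^ (j : ℕ) • w j := fun j =>
    mulVec_eigenSum_mulVec (hω.pow_pow_eq_one j) hVk _
  have h1 : eigenSum k (ω ^ (j : ℕ)) V *ᵥ cyclicVector ω ε V = (c j * k) • w j := by
    rw [hf, mulVec_sum, Finset.sum_eq_single j]
    · rw [mulVec_smul, eigenSum_mulVec_of_mulVec_eq (hω.pow_pow_eq_one j) (hω.pow_pow_eq_one j)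
        (heig j), if_pos rfl, smul_smul]
    · intro i _ hi
      rw [mulVec_smul, eigenSum_mulVec_of_mulVec_eq (hω.pow_pow_eq_one j) (hω.pow_pow_eq_one i)
        (heig i), if_neg, smul_zero]
      exact fun hij => hi (Fin.ext (hω.pow_inj i.2 j.2 hij))
    · simp
  have h2 : star (eigenSum k (ω ^ (j : ℕ)) V *ᵥ cyclicVector ω ε V) ⬝ᵥ ξ = 0 := by
    rw [eigenSum, sum_mulVec, star_sum, sum_dotProduct]
    refine Finset.sum_eq_zero fun m hm => ?_
    rw [smul_pow, smul_mulVec, star_smul, smul_dotProduct, hξ m (Finset.mem_range.1 hm),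
      smul_zero]
  rw [h1, star_smul, smul_dotProduct, smul_eq_mul] at h2
  refine (mul_eq_zero.1 h2).resolve_left (star_ne_zero.2 (mul_ne_zero ?_ hk0))
  exact inv_ne_zero (sqrt_normSqVec_ne_zero (h j))

theorem sum_eigenSum (hω : IsPrimitiveRoot ω k) :
    ∑ j : Fin k, eigenSum k (ω ^ (j : ℕ)) V = (k : ℂ) • 1 := by
  have hω0 : ω ≠ 0 := hω.ne_zero (NeZero.ne k)
  simp only [eigenSum, smul_pow]
  rw [Finset.sum_comm, Finset.sum_eq_single 0]
  · simp [Nat.cast_smul_eq_nsmul]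
  · intro m hm h0
    rw [← Finset.sum_smul]
    have h1 : ω⁻¹ ^ m ≠ 1 :=
      hω.inv.pow_ne_one_of_pos_of_lt h0 (Finset.mem_range.1 hm)
    have h2 : ∑ j : Fin k, ((ω ^ (j : ℕ))⁻¹) ^ m = ∑ j ∈ Finset.range k, (ω⁻¹ ^ m) ^ j := by
      rw [← Fin.sum_univ_eq_sum_range (fun j => (ω⁻¹ ^ m) ^ j) k]
      refine Finset.sum_congr rfl fun j _ => ?_
      rw [← inv_pow, ← pow_mul, ← pow_mul, mul_comm]
    rw [h2, geom_sum_eq h1, hω.inv.pow_pow_eq_one, sub_self, zero_div, zero_smul]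
  · simp [NeZero.ne k]

/-- Vectors whose projections to all eigenspaces are nonzero, one family for each eigenvalue
`ω ^ j` and each standard basis vector, such that the family `(j, i)` uses the basis vector `i` at
`ω ^ j` unless its projection vanishes. -/
theorem exists_component_vectors (hω : IsPrimitiveRoot ω k)
    (hspec : ∀ z : ℂ, z ^ k = 1 → z ∈ spectrum ℂ V) :
    ∃ ε : Fin k × Fin n → Fin k → Fin n → ℂ,
      (∀ s, ∀ j : Fin k, eigenSum k (ω ^ (j : ℕ)) V *ᵥ ε s j ≠ 0) ∧
      ∀ ξ : Fin n → ℂ,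
        (∀ s, ∀ j : Fin k, star (eigenSum k (ω ^ (j : ℕ)) V *ᵥ ε s j) ⬝ᵥ ξ = 0) → ξ = 0 := by
  classical
  have hd : ∀ j : Fin k, ∃ i : Fin n, eigenSum k (ω ^ (j : ℕ)) V *ᵥ Pi.single i 1 ≠ 0 := by
    intro j
    have h1 := eigenSum_ne_zero_of_mem_spectrum (hω.pow_pow_eq_one j)
      (hspec _ (hω.pow_pow_eq_one j))
    by_contra! h2
    refine h1 (Matrix.ext fun a i => ?_)
    simpa using congrFun (h2 i) a
  choose d hd using hd
  refine ⟨fun s j => if s.1 = j ∧ eigenSum k (ω ^ (j : ℕ)) V *ᵥ Pi.single s.2 1 ≠ 0 then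
    Pi.single s.2 1 else Pi.single (d j) 1, fun s j => ?_, fun ξ hξ => ?_⟩
  · dsimp only
    split_ifs with h
    · exact h.2
    · exact hd j
  · have h1 : ∀ (j : Fin k) (i : Fin n),
        star (eigenSum k (ω ^ (j : ℕ)) V *ᵥ Pi.single i 1) ⬝ᵥ ξ = 0 := by
      intro j i
      by_cases h : eigenSum k (ω ^ (j : ℕ)) V *ᵥ Pi.single i 1 = 0
      · rw [h, star_zero, zero_dotProduct]
      · have h2 := hξ (j, i) j
        dsimp only at h2
        rwa [if_pos ⟨rfl, h⟩] at h2
    have hk0 : (k : ℂ) ≠ 0 := Nat.cast_ne_zero.2 (NeZero.ne k)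
    funext i
    have h2 : star ((∑ j : Fin k, eigenSum k (ω ^ (j : ℕ)) V) *ᵥ Pi.single i 1) ⬝ᵥ ξ = 0 := by
      rw [sum_mulVec, star_sum, sum_dotProduct]
      exact Finset.sum_eq_zero fun j _ => h1 j i
    rw [sum_eigenSum hω, smul_mulVec, one_mulVec, star_smul, smul_dotProduct, smul_eq_mul] at h2
    have h3 := (mul_eq_zero.1 h2).resolve_left (star_ne_zero.2 hk0)
    simpa [← Pi.single_star] using h3

end CyclicVector

section LocalProjections

open Filter Topology Matrix

variable {n k : ℕ} [NeZero k]

/-- If `v` has full spectrum, then near `x₀` there are finitely many continuous fields of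
projections, each orthogonal to its nontrivial translates, such that the sum of all translates of
all of them is invertible at `x₀`. -/
theorem exists_local_projections [NeZero n] {Y : Type*} [TopologicalSpace Y] {x₀ : Y}
    {β : Y → (Matrix (Fin n) (Fin n) ℂ ≃⋆ₐ[ℂ] Matrix (Fin n) (Fin n) ℂ)}
    (hc : ∀ᶠ y in 𝓝 x₀, ∀ a, ContinuousAt (fun y => β y a) y) (hβ : ∀ y, β y ^ k = 1)
    {v : Matrix (Fin n) (Fin n) ℂ} (hv : v ∈ unitary (Matrix (Fin n) (Fin n) ℂ))
    (hvk : v ^ k = 1) (hβv : ∀ a, β x₀ a = v * a * star v)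
    (hspec : ∀ z : ℂ, z ^ k = 1 → z ∈ spectrum ℂ v) :
    ∃ q : Fin k × Fin n → Y → Matrix (Fin n) (Fin n) ℂ,
      (∀ s, ∀ᶠ y in 𝓝 x₀, ContinuousAt (q s) y ∧ star (q s y) = q s y ∧
        q s y * q s y = q s y ∧ ∀ m, m ≠ 0 → m < k → (β y ^ m) (q s y) * q s y = 0) ∧
      IsUnit (∑ s, ∑ m ∈ Finset.range k, (β x₀ ^ m) (q s x₀)) := by
  obtain ⟨V, hV0, hV⟩ := exists_local_unitary hc hβ hv hvk hβv
  have hω := Complex.isPrimitiveRoot_exp k (NeZero.ne k)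
  set ω := Complex.exp (2 * Real.pi * Complex.I / k)
  obtain ⟨ε, hε, hspan⟩ := exists_component_vectors hω hspec
  refine ⟨fun s y => vecMulVec (cyclicVector ω (ε s) (V y)) (star (cyclicVector ω (ε s) (V y))),
    fun s => ?_, ?_⟩
  · have hne : ∀ᶠ y in 𝓝 x₀, ∀ j : Fin k, eigenSum k (ω ^ (j : ℕ)) (V y) *ᵥ ε s j ≠ 0 := by
      refine eventually_all.2 fun j => ?_
      have h1 : Continuous fun W : Matrix (Fin n) (Fin n) ℂ =>
          eigenSum k (ω ^ (j : ℕ)) W *ᵥ ε s j :=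
        (continuous_eigenSum k _).matrix_mulVec continuous_const
      have h2 : ContinuousAt (fun y => eigenSum k (ω ^ (j : ℕ)) (V y) *ᵥ ε s j) x₀ :=
        h1.continuousAt.comp hV.self_of_nhds.1
      exact h2.eventually_ne (by rw [hV0]; exact hε s j)
    filter_upwards [hV, hne] with y ⟨hVc, hVu, hVk, hVβ⟩ hy
    set f := cyclicVector ω (ε s) (V y) with hf
    have hdot := fun {m : ℕ} (hm : m < k) =>
      star_cyclicVector_dotProduct_pow_mulVec hω hVu hVk hy hm
    refine ⟨?_, ?_, ?_, fun m hm0 hm => ?_⟩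
    · have h3 : ContinuousAt (fun y => cyclicVector ω (ε s) (V y)) y :=
        ContinuousAt.comp (f := V) (continuousAt_cyclicVector hy) hVc
      have h4 : Continuous fun e : Fin n → ℂ => vecMulVec e (star e) :=
        continuous_id.matrix_vecMulVec continuous_star
      exact ContinuousAt.comp (f := fun y => cyclicVector ω (ε s) (V y)) h4.continuousAt h3
    · rw [star_eq_conjTranspose, conjTranspose_vecMulVec, star_star]
    · have h3 := hdot (NeZero.pos k)
      rw [pow_zero, one_mulVec, if_pos rfl] at h3
      rw [vecMulVec_mul_vecMulVec, h3, one_smul]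
    · have h3 : star (V y ^ m *ᵥ f) ⬝ᵥ f = 0 := by
        rw [star_dotProduct, hdot hm, if_neg hm0, star_zero]
      rw [StarAlgEquiv.pow_apply_of_conj hVβ, conj_vecMulVec_star, vecMulVec_mul_vecMulVec, h3,
        zero_smul, vecMulVec_zero]
  · have hV1 := hV.self_of_nhds
    rw [hV0] at hV1
    simp only [hV0, StarAlgEquiv.pow_apply_of_conj hβv]
    refine isUnit_sum_conj_vecMulVec fun ξ hξ => hspan ξ fun s j => ?_
    exact star_eigenSum_mulVec_dotProduct_eq_zero hω hvk (hε s) (hξ s) j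

end LocalProjections

/-! ### Full spectrum implies finite weak local-triviality dimension -/

section FullSpectrum

open Filter Topology

variable {X : Type*} [TopologicalSpace X] {E : X → Type*} [∀ x, CStarAlgebra (E x)]
  [TopologicalSpace (TotalSpace Unit E)]

/-- In a local trivialization, the projections constructed for matrix algebras are multiplied by
a bump function to give equivariant homomorphisms from the cone. -/
theorem BundleAction.IsImplementedAt.exists_isConeSum [CompactSpace X] [T2Space X]
    [IsMatrixBundle E] {k : ℕ} [NeZero k] {α : BundleAction E (Multiplicative (ZMod k))} {x₀ : X}
    {v : E x₀} (hv : α.IsImplementedAt x₀ v) (hspec : spectrum ℂ v = {z : ℂ | z ^ k = 1}) :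
    ∃ a, IsConeSum α.onSections a ∧ IsUnit (a x₀) := by
  classical
  obtain ⟨n, hn, e, hx₀, he⟩ := IsMatrixBundle.exists_trivialization (E := E) x₀
  have : NeZero n := ⟨hn.ne'⟩
  choose φ hφ using he
  -- `fld m` is the section with coordinates `m` in the trivialization, extended by `0`.
  set fld : (X → Matrix (Fin n) (Fin n) ℂ) → ∀ x, E x :=
    fun m x => if h : x ∈ e.baseSet then (φ x h).symm (m x) else 0
  have hfld : ∀ m x (h : x ∈ e.baseSet), fld m x = (φ x h).symm (m x) := fun m x h => dif_pos h
  have hfldc : ∀ m x, x ∈ e.baseSet → ContinuousAt m x →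
      ContinuousAt (fun x => (⟨x, fld m x⟩ : TotalSpace Unit E)) x := by
    intro m x hx hm
    refine (continuousAt_section_iff hx).2 (hm.congr ?_)
    filter_upwards [eventually_baseSet hx] with y hy
    rw [hφ y hy, hfld m y hy, StarAlgEquiv.apply_symm_apply]
  set γ : ∀ x, E x ≃⋆ₐ[ℂ] E x := fun x => α.fiber x (Multiplicative.ofAdd 1)
  -- `β x` is the action of the generator in the trivialization, extended by the identity.
  set β : X → (Matrix (Fin n) (Fin n) ℂ ≃⋆ₐ[ℂ] Matrix (Fin n) (Fin n) ℂ) := fun x =>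
    if h : x ∈ e.baseSet then ((φ x h).symm.trans (γ x)).trans (φ x h) else 1
  have hβ : ∀ x (h : x ∈ e.baseSet), β x = ((φ x h).symm.trans (γ x)).trans (φ x h) :=
    fun x h => dif_pos h
  have hβk : ∀ x, β x ^ k = 1 := by
    intro x
    by_cases h : x ∈ e.baseSet
    · ext1 a
      rw [hβ x h, StarAlgEquiv.conj_pow_apply, α.fiber_ofAdd_one_pow]
      simp
    · have h1 : β x = 1 := dif_neg h
      rw [h1, one_pow]
  have hβc : ∀ᶠ x in 𝓝 x₀, ∀ a, ContinuousAt (fun x => β x a) x := by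
    filter_upwards [eventually_baseSet hx₀] with x hx a
    have h1 : ContinuousAt (fun y => (⟨y, γ y (fld (fun _ => a) y)⟩ : TotalSpace Unit E)) x :=
      ContinuousAt.comp (f := fun y => (⟨y, fld (fun _ => a) y⟩ : TotalSpace Unit E))
        (α.continuous_act (Multiplicative.ofAdd 1)).continuousAt (hfldc _ x hx continuousAt_const)
    refine ((continuousAt_section_iff hx).1 h1).congr ?_
    filter_upwards [eventually_baseSet hx] with y hy
    rw [hφ y hy, hβ y hy]
    exact congrArg (fun b => φ y hy (γ y b)) (hfld (fun _ => a) y hy)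
  have hvu : φ x₀ hx₀ v ∈ unitary (Matrix (Fin n) (Fin n) ℂ) := by
    have h1 := Unitary.mem_iff.1 hv.1
    rw [Unitary.mem_iff, ← map_star, ← map_mul, ← map_mul, h1.1, h1.2, map_one]
    exact ⟨rfl, rfl⟩
  have hvβ : ∀ a, β x₀ a = φ x₀ hx₀ v * a * star (φ x₀ hx₀ v) := by
    intro a
    rw [hβ x₀ hx₀]
    change φ x₀ hx₀ (γ x₀ ((φ x₀ hx₀).symm a)) = _
    rw [hv.2.2]
    simp [map_star]
  obtain ⟨q, hq, hu⟩ := exists_local_projections hβc hβk hvu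
    (by rw [← map_pow, hv.2.1, map_one]) hvβ fun z hz => by
      have h1 : z ∈ spectrum ℂ v := by rw [hspec]; exact hz
      intro h2
      refine h1 ?_
      have h3 := IsUnit.map (φ x₀ hx₀).symm h2
      rwa [map_sub, StarAlgEquiv.symm_apply_apply, AlgHomClass.commutes] at h3
  obtain ⟨W, hW, hWo, hxW⟩ := eventually_nhds_iff.1
    ((eventually_baseSet hx₀).and (eventually_all.2 hq))
  obtain ⟨χ, hχW, hχ1, hχ⟩ := exists_tsupport_one_of_isOpen_isClosed hWo
    isClosed_closure.isCompact isClosed_singleton (Set.singleton_subset_iff.2 hxW)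
  have hpow : ∀ (g : Multiplicative (ZMod k)) x (h : x ∈ e.baseSet) s,
      φ x h (α.fiber x g (fld (q s) x)) = (β x ^ (g.toAdd).val) (q s x) := by
    intro g x h s
    rw [hβ x h, StarAlgEquiv.conj_pow_apply, hfld _ x h, α.fiber_eq_pow]
  have hcone : ∀ s, ∃ a, IsConeSum α.onSections a ∧
      ∀ x, a x = (χ x : ℂ) • ∑ g, α.fiber x g (fld (q s) x) := by
    intro s
    refine isConeSum_of_projections α χ hχ fun x hx => ?_
    obtain ⟨hxe, hxq⟩ := hW x (hχW hx)
    obtain ⟨h1, h2, h3, h4⟩ := hxq s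
    refine ⟨hfldc _ x hxe h1, ?_, ?_, fun g hg => ?_⟩
    · rw [hfld _ x hxe, ← map_star, h2]
    · rw [hfld _ x hxe, ← map_mul, h3]
    · refine (map_eq_zero_iff (φ x hxe) (φ x hxe).injective).1 ?_
      rw [map_mul, hpow, hfld _ x hxe, StarAlgEquiv.apply_symm_apply]
      refine h4 _ (fun h0 => hg ?_) (ZMod.val_lt _)
      exact Multiplicative.toAdd.injective ((ZMod.val_eq_zero _).1 h0)
  choose a ha hax using hcone
  refine ⟨∑ s, a s, IsConeSum.sum _ fun s _ => ha s, ?_⟩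
  have h1 : φ x₀ hx₀ ((∑ s, a s : SectionAlgebra E) x₀) =
      ∑ s, ∑ m ∈ Finset.range k, (β x₀ ^ m) (q s x₀) := by
    change φ x₀ hx₀ (SectionAlgebra.evalHom x₀ (∑ s, a s)) = _
    rw [map_sum, map_sum]
    refine Finset.sum_congr rfl fun s _ => ?_
    change φ x₀ hx₀ (a s x₀) = _
    have hχ0 : χ x₀ = 1 := hχ1 rfl
    rw [hax, hχ0, Complex.ofReal_one, one_smul, map_sum,
      ← sum_zmod_val (fun m => (β x₀ ^ m) (q s x₀))]
    exact Finset.sum_congr rfl fun g _ => hpow g x₀ hx₀ s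
  rw [← h1] at hu
  have h2 := hu.map (φ x₀ hx₀).symm
  rwa [StarAlgEquiv.symm_apply_apply] at h2

end FullSpectrum

theorem weakLTDim_lt_top_iff {G : Type*} [Group G] [Finite G] {A : Type*} [CStarAlgebra A]
    {α : G →* (A ≃⋆ₐ[ℂ] A)} : weakLTDim α < ⊤ ↔ ∃ n, IsWeakLTAdmissible α n := by
  rw [weakLTDim, sInf_lt_iff]
  constructor
  · rintro ⟨_, ⟨n, -, hn⟩, -⟩
    exact ⟨n, hn⟩
  · rintro ⟨n, hn⟩
    exact ⟨n, ⟨n, rfl, hn⟩, ENat.natCast_lt_top n⟩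

theorem mainTheorem5 {X : Type*} [TopologicalSpace X] [CompactSpace X] [T2Space X]
    (E : X → Type*) [∀ x, CStarAlgebra (E x)] [TopologicalSpace (TotalSpace Unit E)]
    [IsMatrixBundle E] (k : ℕ) [NeZero k] (α : BundleAction E (Multiplicative (ZMod k))) :
    (∀ x, ∃ v : E x, α.IsImplementedAt x v) ∧
    List.TFAE [
      ∀ (x : X) (v : E x), α.IsImplementedAt x v → spectrum ℂ v = {z : ℂ | z ^ k = 1},
      weakLTDim α.onSections < ⊤,
      IsFreeAction α.onSections] := by
  refine ⟨α.exists_isImplementedAt, ?_⟩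
  tfae_have 1 → 2 := fun h => weakLTDim_lt_top_iff.2 <|
    exists_isWeakLTAdmissible_of_forall_isUnit_apply fun x => by
      obtain ⟨v, hv⟩ := α.exists_isImplementedAt x
      exact hv.exists_isConeSum (h x v hv)
  tfae_have 2 → 3 := fun h => by
    obtain ⟨n, hn⟩ := weakLTDim_lt_top_iff.1 h
    exact hn.isFreeAction
  tfae_have 3 → 1 := fun h x v hv => hv.spectrum_eq_of_isFreeAction h
  tfae_finish
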